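/- **Definitions.** Let $\mathcal C\subset\mathbb R^n$ be a nonempty bounded open convex set, and let $\|\cdot\|_e$ be the Euclidean norm. For distinct $p,q\in\mathcal C$, let the line through $p,q$ meet $\partial\mathcal C$ in $a,b$, in the order $a,p,q,b$. The Hilbert distance is $$d_{\mathcal C}(p,q)=\tfrac12\ln\left(\frac{\|q-a\|_e}{\|p-a\|_e}\cdot\frac{\|p-b\|_e}{\|q-b\|_e}\right),\qquad d_{\mathcal C}(p,p)=0.$$ For $p\in\mathcal C$ and $u\neq0$, let $p^{\pm}$ be the points where the rays from $p$ in the directions $\pm u$ meet $\partial\mathcal C$. Put $$\|u\|_{\mathcal C,p}=\tfrac12\|u\|_e\left(\frac1{\|p-p^+\|_e}+\frac1{\|p-p^-\|_e}\right),\qquad \|0\|_{\mathcal C,p}=0,$$ and $\|l\|^*_{\mathcal C,p}=\sup\{l(u):\|u\|_{\mathcal C,p}=1\}$ for linear forms $l$. The Hilbert (Busemann) measure $\mu_{\mathcal C}$ on $\mathcal C$ has Lebesgue density $p\mapsto\omega_n/\mathrm{vol}_e\{u:\|u\|_{\mathcal C,p}<1\}$, where $\omega_n$ is the volume of the Euclidean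 unit ball of $\mathbb R^n$. The bottom of the spectrum is $$\lambda_1(\mathcal C)=\inf_f\frac{\int_{\mathcal C}(\|df_p\|^*_{\mathcal C,p})^2\,d\mu_{\mathcal C}(p)}{\int_{\mathcal C}f^2\,d\mu_{\mathcal C}},$$ the infimum being over all nonzero Lipschitz functions $f$ with compact support in $\mathcal C$. The Cheeger constant is $$I^\infty(\mathcal C)=\inf_U\frac{\nu_{\mathcal C}(\partial U)}{\mu_{\mathcal C}(U)},$$ the infimum being over all nonempty open sets $U$ with compact closure contained in $\mathcal C$ and with $\partial U$ a $C^1$ submanifold of dimension $n-1$; here $\nu_{\mathcal C}$ is the $(n-1)$-dimensional Hausdorff measure of $d_{\mathcal C}$, normalized by the factor $\omega_{n-1}/2^{n-1}$. The space $(\mathcal C,d_{\mathcal C})$ is Gromov-hyperbolic if for some $\delta>0$ and all $w,x,y,z\in\mathcal C$ one has $(x|z)_w\ge\min\{(x|y)_w,(y|z)_w\}-\delta$, where $(x|y)_w=\tfrac12\left(d_{\mathcal C}(x,w)+d_{\mathcal C}(y,w)-d_{\mathcal C}(x,y)\right)$. **Proposition 4.1.** Let $\mathcal C=\{(x,y,z)\in\mathbb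 R^3: x^2+y^2<1,\ |z|<1\}$ be the cylinder of height $2$ over the unit disk; it is a nonempty bounded open convex set. Then $I^\infty(\mathcal C)>0$ and $\lambda_1(\mathcal C)>0$. However, $\mathcal C$ is not strictly convex (its closure is not a strictly convex set), and $(\mathcal C,d_{\mathcal C})$ is not Gromov-hyperbolic. Consequently, for nonempty bounded open convex sets in $\mathbb R^3$, neither $\lambda_1>0$ nor $I^\infty>0$ implies Gromov-hyperbolicity of the Hilbert geometry. -/

import Mathlib

open scoped ENNReal NNReal

noncomputable section

namespace HilbertGeometry

/-- Domains carrying a Hilbert geometry: nonempty bounded open convex subsets of `ℝⁿ`. -/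
structure IsHilbertDomain {n : ℕ} (C : Set (EuclideanSpace ℝ (Fin n))) : Prop where
  nonempty : C.Nonempty
  isOpen : IsOpen C
  convex : Convex ℝ C
  bounded : Bornology.IsBounded C

/-- The point at which the ray from `p ∈ C` in the direction `u ≠ 0` meets the boundary of the
bounded convex open set `C`. -/
def exitPoint {n : ℕ} (C : Set (EuclideanSpace ℝ (Fin n))) (p u : EuclideanSpace ℝ (Fin n)) :
    EuclideanSpace ℝ (Fin n) :=
  p + sSup {t : ℝ | 0 ≤ t ∧ p + t • u ∈ C} • u

open Classical in
/-- The Hilbert distance `(1/2) log [a, p, q, b]`, where the line through `p ≠ q` meets the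
boundary of `C` in `a` and `b`, in the order `a, p, q, b`. -/
def hilbertDist {n : ℕ} (C : Set (EuclideanSpace ℝ (Fin n))) (p q : EuclideanSpace ℝ (Fin n)) :
    ℝ :=
  if p = q then 0
  else
    (1 / 2) * Real.log
      ((‖q - exitPoint C p (p - q)‖ / ‖p - exitPoint C p (p - q)‖) *
        (‖p - exitPoint C q (q - p)‖ / ‖q - exitPoint C q (q - p)‖))

/-- The Finsler norm at `p ∈ C` of the tangent vector `u` (it is `0` for `u = 0`). -/
def finslerNorm {n : ℕ} (C : Set (EuclideanSpace ℝ (Fin n))) (p u : EuclideanSpace ℝ (Fin n)) :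
    ℝ :=
  (1 / 2) * ‖u‖ * (1 / ‖p - exitPoint C p u‖ + 1 / ‖p - exitPoint C p (-u)‖)

/-- The dual norm of a linear form on the tangent space at `p`. -/
def dualNorm {n : ℕ} (C : Set (EuclideanSpace ℝ (Fin n))) (p : EuclideanSpace ℝ (Fin n))
    (l : EuclideanSpace ℝ (Fin n) →L[ℝ] ℝ) : ℝ :=
  sSup {r : ℝ | ∃ u : EuclideanSpace ℝ (Fin n), finslerNorm C p u = 1 ∧ l u = r}

/-- The open unit ball of the tangent space at `p`. -/
def tangentBall {n : ℕ} (C : Set (EuclideanSpace ℝ (Fin n))) (p : EuclideanSpace ℝ (Fin n)) :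
    Set (EuclideanSpace ℝ (Fin n)) :=
  {u | finslerNorm C p u < 1}

/-- The volume `ω_n` of the Euclidean unit ball of `ℝⁿ`. -/
def unitBallVolume (n : ℕ) : ℝ≥0∞ :=
  MeasureTheory.volume (Metric.ball (0 : EuclideanSpace ℝ (Fin n)) 1)

/-- The Hilbert (Busemann) measure of `C`: density `ω_n / vol (TB_C p)` with respect to Lebesgue
measure on `C`. -/
def hilbertMeasure {n : ℕ} (C : Set (EuclideanSpace ℝ (Fin n))) :
    MeasureTheory.Measure (EuclideanSpace ℝ (Fin n)) :=
  (MeasureTheory.volume.restrict C).withDensity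
    fun p => unitBallVolume n / MeasureTheory.volume (tangentBall C p)

/-- The Rayleigh quotient of `f`. -/
def rayleighQuotient {n : ℕ} (C : Set (EuclideanSpace ℝ (Fin n)))
    (f : EuclideanSpace ℝ (Fin n) → ℝ) : ℝ≥0∞ :=
  (∫⁻ p, ENNReal.ofReal (dualNorm C p (fderiv ℝ f p) ^ 2) ∂(hilbertMeasure C)) /
    (∫⁻ p, ENNReal.ofReal (f p ^ 2) ∂(hilbertMeasure C))

/-- Nonzero Lipschitz functions with compact support contained in `C` (extended by zero). -/
structure IsTestFunction {n : ℕ} (C : Set (EuclideanSpace ℝ (Fin n)))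
    (f : EuclideanSpace ℝ (Fin n) → ℝ) : Prop where
  lipschitz : ∃ K : ℝ≥0, LipschitzWith K f
  compactSupport : HasCompactSupport f
  support_subset : tsupport f ⊆ C
  ne_zero : f ≠ 0

/-- The bottom of the spectrum `λ₁(C)`. -/
def bottomOfSpectrum {n : ℕ} (C : Set (EuclideanSpace ℝ (Fin n))) : ℝ≥0∞ :=
  ⨅ (f : EuclideanSpace ℝ (Fin n) → ℝ) (_ : IsTestFunction C f), rayleighQuotient C f

/-- The diameter of a subset of `C` for the Hilbert distance. -/
def hilbertDiam {n : ℕ} (C : Set (EuclideanSpace ℝ (Fin n)))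
    (A : Set (EuclideanSpace ℝ (Fin n))) : ℝ≥0∞ :=
  ⨆ (x ∈ A) (y ∈ A), ENNReal.ofReal (hilbertDist C x y)

/-- The `k`-dimensional Hausdorff measure, for the Hilbert distance, of a subset `A` of `C`, with
the usual normalization `ω_k / 2 ^ k` (it is the one for which Hausdorff measure agrees with the
volume of Euclidean spaces). -/
def hilbertHausdorff {n : ℕ} (C : Set (EuclideanSpace ℝ (Fin n))) (k : ℕ)
    (A : Set (EuclideanSpace ℝ (Fin n))) : ℝ≥0∞ :=
  (unitBallVolume k / 2 ^ k) *
    ⨆ (r : ℝ≥0∞) (_ : 0 < r),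
      ⨅ (t : ℕ → Set (EuclideanSpace ℝ (Fin n)))
        (_ : (∀ i, t i ⊆ C) ∧ A ⊆ ⋃ i, t i ∧ ∀ i, hilbertDiam C (t i) ≤ r),
        ∑' i, ⨆ (_ : (t i).Nonempty), hilbertDiam C (t i) ^ k

/-- `S` is an embedded `C¹` submanifold of codimension one of `ℝⁿ`: locally it is the zero set of
a `C¹` function with nonvanishing differential. -/
def IsHypersurface {n : ℕ} (S : Set (EuclideanSpace ℝ (Fin n))) : Prop :=
  ∀ p ∈ S, ∃ (V : Set (EuclideanSpace ℝ (Fin n))) (g : EuclideanSpace ℝ (Fin n) → ℝ),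
    IsOpen V ∧ p ∈ V ∧ ContDiffOn ℝ 1 g V ∧ (∀ x ∈ V, fderiv ℝ g x ≠ 0) ∧
      S ∩ V = {x ∈ V | g x = 0}

/-- Nonempty open sets with compact closure in `C` whose boundary is a hypersurface. -/
structure IsCheegerDomain {n : ℕ} (C U : Set (EuclideanSpace ℝ (Fin n))) : Prop where
  nonempty : U.Nonempty
  isOpen : IsOpen U
  compact_closure : IsCompact (closure U)
  closure_subset : closure U ⊆ C
  hypersurface : IsHypersurface (frontier U)

/-- The Cheeger constant `I^∞(C)`. -/
def cheegerConstant {n : ℕ} (C : Set (EuclideanSpace ℝ (Fin n))) : ℝ≥0∞ :=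
  ⨅ (U : Set (EuclideanSpace ℝ (Fin n))) (_ : IsCheegerDomain C U),
    hilbertHausdorff C (n - 1) (frontier U) / hilbertMeasure C U

/-- The Gromov product `(x | y)_w` for the Hilbert distance. -/
def gromovProduct {n : ℕ} (C : Set (EuclideanSpace ℝ (Fin n)))
    (w x y : EuclideanSpace ℝ (Fin n)) : ℝ :=
  (1 / 2) * (hilbertDist C x w + hilbertDist C y w - hilbertDist C x y)

/-- `(C, d_C)` is hyperbolic in the sense of Gromov. -/
def IsGromovHyperbolic {n : ℕ} (C : Set (EuclideanSpace ℝ (Fin n))) : Prop :=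
  ∃ δ : ℝ, 0 < δ ∧ ∀ w ∈ C, ∀ x ∈ C, ∀ y ∈ C, ∀ z ∈ C,
    min (gromovProduct C w x y) (gromovProduct C w y z) - δ ≤ gromovProduct C w x z

/-- The open cylinder of height `2` over the unit disk. -/
def cylinder : Set (EuclideanSpace ℝ (Fin 3)) :=
  {x | x 0 ^ 2 + x 1 ^ 2 < 1 ∧ |x 2| < 1}

end HilbertGeometry

end

/-!
Write `r = 1 - x² - y²`, `c = 1 - y²`, `h = 1 - z²`. At each point of the cylinder the Finsler unit
ball is trapped between two multiples of an explicit ellipsoid, so the Hilbert measure is comparable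
to `w dx dy dz` with `w = r ^ (-3/2) * h⁻¹`. The function `Φ = x / (√r * c * h)` satisfies
`∂Φ/∂x = w` and `|Φ| ‖∂/∂x‖ ≤ 2 w`. Integrating `∂(f² Φ)/∂x` over the cylinder therefore gives a
Hardy inequality, which bounds the spectrum from below. Integrating `w` along the lines parallel to
the first axis bounds the mass of a domain by twice the integral of `sup |Φ|` over the projection of
its boundary, and a set of small Hilbert diameter `d` has a projection of area `O(d²) / sup |Φ|`;
this bounds the Cheeger constant from below.

The plane `y = 0` meets the cylinder in a square. As `s → 1`, the distances between `(0, 0)`,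
`(s, 0)`, `(s, s)`, `(0, s)` all agree, except that the one from `(s, 0)` to `(0, s)` is about twice
as large, which is incompatible with the Gromov inequality.
-/

namespace HilbertGeometry

open Filter MeasureTheory Topology

section Funk

variable {n : ℕ} {C : Set (EuclideanSpace ℝ (Fin n))} {p q u : EuclideanSpace ℝ (Fin n)}

/-- The Funk norm of `u` at `p`: the inverse of the time at which `t ↦ p + t • u` leaves `C`. -/
noncomputable def funkNorm (C : Set (EuclideanSpace ℝ (Fin n))) (p u : EuclideanSpace ℝ (Fin n)) :
    ℝ :=
  gauge {v | p + v ∈ C} u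

lemma funkNorm_nonneg : 0 ≤ funkNorm C p u :=
  gauge_nonneg u

lemma funkNorm_lt_iff (hC : IsHilbertDomain C) (hp : p ∈ C) {s : ℝ} (hs : 0 < s) :
    funkNorm C p u < s ↔ p + s⁻¹ • u ∈ C := by
  have hconv : Convex ℝ {v | p + v ∈ C} := hC.convex.translate_preimage_right p
  have hopen : IsOpen {v | p + v ∈ C} := hC.isOpen.preimage (continuous_const_add p)
  have hball := setOfPred_gauge_lt_one_eq_self_of_isOpen hconv (by simpa using hp) hopen
  rw [← Set.mem_ofPred_eq (p := fun v => p + v ∈ C), ← hball, Set.mem_ofPred_eq,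
    gauge_smul_of_nonneg (inv_nonneg.2 hs.le), smul_eq_mul, inv_mul_lt_one₀ hs, funkNorm]

lemma funkNorm_pos (hC : IsHilbertDomain C) (hp : p ∈ C) (hu : u ≠ 0) : 0 < funkNorm C p u := by
  have hnhds : {v | p + v ∈ C} ∈ nhds 0 :=
    (hC.isOpen.preimage (continuous_const_add p)).mem_nhds (by simpa using hp)
  have hbdd : Bornology.IsBounded {v | p + v ∈ C} :=
    (hC.bounded.vadd (-p)).subset fun v hv => ⟨p + v, hv, neg_vadd_vadd p v⟩
  exact (gauge_pos (absorbent_nhds_zero hnhds) (NormedSpace.isVonNBounded_iff ℝ |>.2 hbdd)).2 hu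

lemma exitTimes_eq_Ico (hC : IsHilbertDomain C) (hp : p ∈ C) (hu : u ≠ 0) :
    {t : ℝ | 0 ≤ t ∧ p + t • u ∈ C} = Set.Ico 0 (funkNorm C p u)⁻¹ := by
  ext t
  refine and_congr_right fun ht => ?_
  rcases ht.eq_or_lt with rfl | ht
  · simpa [hp] using funkNorm_pos hC hp hu
  · rw [lt_inv_comm₀ ht (funkNorm_pos hC hp hu), funkNorm_lt_iff hC hp (inv_pos.2 ht), inv_inv]

lemma exitPoint_eq (hC : IsHilbertDomain C) (hp : p ∈ C) (hu : u ≠ 0) :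
    exitPoint C p u = p + (funkNorm C p u)⁻¹ • u := by
  rw [exitPoint, exitTimes_eq_Ico hC hp hu, csSup_Ico (inv_pos.2 (funkNorm_pos hC hp hu))]

lemma finslerNorm_eq (hC : IsHilbertDomain C) (hp : p ∈ C) (u : EuclideanSpace ℝ (Fin n)) :
    finslerNorm C p u = 1 / 2 * (funkNorm C p u + funkNorm C p (-u)) := by
  rcases eq_or_ne u 0 with rfl | hu
  · simp [finslerNorm, funkNorm]
  have := norm_pos_iff.2 hu
  have hdist {v : EuclideanSpace ℝ (Fin n)} (hv : v ≠ 0) :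
      1 / ‖p - exitPoint C p v‖ = funkNorm C p v / ‖v‖ := by
    rw [exitPoint_eq hC hp hv, sub_add_cancel_left, norm_neg, norm_smul,
      Real.norm_of_nonneg (inv_nonneg.2 funkNorm_nonneg), one_div, mul_inv, inv_inv, div_eq_mul_inv]
  rw [finslerNorm, hdist hu, hdist (neg_ne_zero.2 hu), norm_neg]
  field_simp

lemma exp_two_mul_hilbertDist (hC : IsHilbertDomain C) (hp : p ∈ C) (hq : q ∈ C) :
    Real.exp (2 * hilbertDist C p q) =
      (1 + funkNorm C p (p - q)) * (1 + funkNorm C q (q - p)) := by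
  rcases eq_or_ne p q with rfl | hpq
  · simp [hilbertDist, funkNorm]
  have hratio {a b : EuclideanSpace ℝ (Fin n)} (ha : a ∈ C) (hab : a ≠ b) :
      ‖b - exitPoint C a (a - b)‖ / ‖a - exitPoint C a (a - b)‖ = 1 + funkNorm C a (a - b) := by
    have hne : a - b ≠ 0 := sub_ne_zero.2 hab
    have hF := funkNorm_pos hC ha hne
    have hb : b - (a + (funkNorm C a (a - b))⁻¹ • (a - b)) =
        (-(1 + (funkNorm C a (a - b))⁻¹)) • (a - b) := by module
    have := norm_pos_iff.2 hne
    rw [exitPoint_eq hC ha hne, hb, sub_add_cancel_left, norm_neg, norm_smul, norm_smul, norm_neg,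
      Real.norm_of_nonneg (by positivity), Real.norm_of_nonneg (by positivity)]
    field_simp
    exact add_comm _ _
  have hpos : 0 < (1 + funkNorm C p (p - q)) * (1 + funkNorm C q (q - p)) := by
    have := funkNorm_nonneg (C := C) (p := p) (u := p - q)
    have := funkNorm_nonneg (C := C) (p := q) (u := q - p)
    positivity
  rw [hilbertDist, if_neg hpq, hratio hp hpq, hratio hq hpq.symm, ← mul_assoc,
    mul_one_div_cancel two_ne_zero, one_mul, Real.exp_log hpos]

lemma one_add_funkNorm_le_exp (hC : IsHilbertDomain C) (hp : p ∈ C) (hq : q ∈ C) :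
    1 + funkNorm C q (q - p) ≤ Real.exp (2 * hilbertDist C p q) := by
  rw [exp_two_mul_hilbertDist hC hp hq]
  exact le_mul_of_one_le_left (by linarith [funkNorm_nonneg (C := C) (p := q) (u := q - p)])
    (by linarith [funkNorm_nonneg (C := C) (p := p) (u := p - q)])

lemma le_exp_hilbertDist_mul_of_concaveOn (hC : IsHilbertDomain C)
    {g : EuclideanSpace ℝ (Fin n) → ℝ} (hg : ConcaveOn ℝ C g) (hg0 : ∀ x ∈ C, 0 ≤ g x)
    (hp : p ∈ C) (hq : q ∈ C) : g p ≤ Real.exp (2 * hilbertDist C p q) * g q := by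
  have hlt : ∀ s > funkNorm C q (q - p), g p ≤ (1 + s) * g q := fun s hs => by
    have hs0 : 0 < s := funkNorm_nonneg.trans_lt hs
    have hx : q + s⁻¹ • (q - p) ∈ C := (funkNorm_lt_iff hC hq hs0).1 hs
    have hcomb : (1 / (1 + s)) • p + (s / (1 + s)) • (q + s⁻¹ • (q - p)) = q := by
      match_scalars <;> field_simp <;> ring
    have hconc := hg.2 hp hx (by positivity : 0 ≤ 1 / (1 + s)) (by positivity : 0 ≤ s / (1 + s))
      (by field_simp)
    rw [hcomb, smul_eq_mul, smul_eq_mul] at hconc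
    have : 1 / (1 + s) * g p ≤ g q :=
      (le_add_of_nonneg_right (mul_nonneg (by positivity) (hg0 _ hx))).trans hconc
    rwa [one_div, inv_mul_le_iff₀ (by positivity)] at this
  have hlim : Tendsto (fun s => (1 + s) * g q) (𝓝[>] funkNorm C q (q - p))
      (𝓝 ((1 + funkNorm C q (q - p)) * g q)) :=
    (Continuous.tendsto (by fun_prop) _).mono_left nhdsWithin_le_nhds
  have hle := ge_of_tendsto hlim (eventually_nhdsWithin_of_forall hlt)
  exact hle.trans (mul_le_mul_of_nonneg_right (one_add_funkNorm_le_exp hC hp hq) (hg0 q hq))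

lemma funkNorm_sub_le (hC : IsHilbertDomain C) (hp : p ∈ C) (hq : q ∈ C) :
    funkNorm C p (q - p) ≤ funkNorm C q (q - p) := by
  refine le_of_forall_gt fun s hs => ?_
  have hs0 : 0 < s := funkNorm_nonneg.trans_lt hs
  have hx := (funkNorm_lt_iff hC hq hs0).1 hs
  have hline : q + s⁻¹ • (q - p) = p + (s / (s + 1))⁻¹ • (q - p) := by
    match_scalars <;> field_simp
    ring
  rw [hline, ← funkNorm_lt_iff hC hp (by positivity)] at hx
  exact hx.trans (div_lt_self hs0 (by linarith))

lemma hilbertDist_nonneg (hC : IsHilbertDomain C) (hp : p ∈ C) (hq : q ∈ C) :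
    0 ≤ hilbertDist C p q := by
  have : 1 ≤ Real.exp (2 * hilbertDist C p q) :=
    (le_add_of_nonneg_right funkNorm_nonneg).trans (one_add_funkNorm_le_exp hC hp hq)
  linarith [Real.one_le_exp_iff.1 this]

lemma finslerNorm_sub_le_four_mul_hilbertDist (hC : IsHilbertDomain C) (hp : p ∈ C) (hq : q ∈ C)
    (hd : hilbertDist C p q ≤ 1 / 2) : finslerNorm C p (q - p) ≤ 4 * hilbertDist C p q := by
  set a := funkNorm C p (p - q)
  set b := funkNorm C q (q - p)
  have ha : 0 ≤ a := funkNorm_nonneg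
  have hb : 0 ≤ b := funkNorm_nonneg
  have hexp : Real.exp (2 * hilbertDist C p q) = (1 + a) * (1 + b) :=
    exp_two_mul_hilbertDist hC hp hq
  have hd0 := hilbertDist_nonneg hC hp hq
  have hquad : Real.exp (2 * hilbertDist C p q) ≤ 1 + 4 * hilbertDist C p q := by
    have hd1 : |2 * hilbertDist C p q| ≤ 1 := by rw [abs_of_nonneg (by linarith)]; linarith
    nlinarith [(abs_le.1 (Real.abs_exp_sub_one_sub_id_le hd1)).2]
  rw [finslerNorm_eq hC hp, neg_sub]
  nlinarith [funkNorm_sub_le hC hp hq]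

end Funk

section Finsler

variable {n : ℕ} {C : Set (EuclideanSpace ℝ (Fin n))} {p u : EuclideanSpace ℝ (Fin n)}
  {G : Type*} [NormedAddCommGroup G] [NormedSpace ℝ G]

lemma finslerNorm_nonneg (hC : IsHilbertDomain C) (hp : p ∈ C) : 0 ≤ finslerNorm C p u := by
  rw [finslerNorm_eq hC hp]
  have := funkNorm_nonneg (C := C) (p := p) (u := u)
  have := funkNorm_nonneg (C := C) (p := p) (u := -u)
  positivity

lemma finslerNorm_pos (hC : IsHilbertDomain C) (hp : p ∈ C) (hu : u ≠ 0) :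
    0 < finslerNorm C p u := by
  rw [finslerNorm_eq hC hp]
  have := funkNorm_pos hC hp hu
  have := funkNorm_pos hC hp (neg_ne_zero.2 hu)
  positivity

lemma finslerNorm_neg (hC : IsHilbertDomain C) (hp : p ∈ C) :
    finslerNorm C p (-u) = finslerNorm C p u := by
  rw [finslerNorm_eq hC hp, finslerNorm_eq hC hp, neg_neg, add_comm]

lemma finslerNorm_smul_of_nonneg (hC : IsHilbertDomain C) (hp : p ∈ C) {c : ℝ} (hc : 0 ≤ c) :
    finslerNorm C p (c • u) = c * finslerNorm C p u := by
  rw [finslerNorm_eq hC hp, finslerNorm_eq hC hp, ← smul_neg, funkNorm, funkNorm,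
    gauge_smul_of_nonneg hc, gauge_smul_of_nonneg hc, smul_eq_mul, smul_eq_mul, funkNorm, funkNorm]
  ring

lemma norm_map_le_mul_finslerNorm (hC : IsHilbertDomain C) (hp : p ∈ C)
    (L : EuclideanSpace ℝ (Fin n) →ₗ[ℝ] G) {a : ℝ}
    (hL : ∀ v, p + v ∈ C → p - v ∈ C → ‖L v‖ ≤ a) : ‖L u‖ ≤ 2 * a * finslerNorm C p u := by
  have hlt : ∀ s > 2 * finslerNorm C p u, ‖L u‖ ≤ a * s := fun s hs => by
    have hs0 : 0 < s := (mul_nonneg zero_le_two (finslerNorm_nonneg hC hp)).trans_lt hs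
    rw [finslerNorm_eq hC hp] at hs
    have h₁ : funkNorm C p u < s := by linarith [funkNorm_nonneg (C := C) (p := p) (u := -u)]
    have h₂ : funkNorm C p (-u) < s := by linarith [funkNorm_nonneg (C := C) (p := p) (u := u)]
    rw [funkNorm_lt_iff hC hp hs0] at h₁ h₂
    have := hL _ h₁ (by rwa [sub_eq_add_neg, ← smul_neg])
    rwa [map_smul, norm_smul, Real.norm_of_nonneg (inv_nonneg.2 hs0.le), inv_mul_le_iff₀ hs0,
      mul_comm] at this
  have hlim : Tendsto (fun s => a * s) (𝓝[>] (2 * finslerNorm C p u))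
      (𝓝 (a * (2 * finslerNorm C p u))) :=
    (Continuous.tendsto (by fun_prop) _).mono_left nhdsWithin_le_nhds
  linarith [ge_of_tendsto hlim (eventually_nhdsWithin_of_forall hlt)]

lemma finslerNorm_le_mul_norm_map (hC : IsHilbertDomain C) (hp : p ∈ C)
    (L : EuclideanSpace ℝ (Fin n) →ₗ[ℝ] G) {b : ℝ} (hb : 0 < b)
    (hL : ∀ v, ‖L v‖ < b⁻¹ → p + v ∈ C) : finslerNorm C p u ≤ b * ‖L u‖ := by
  have hfunk (v : EuclideanSpace ℝ (Fin n)) : funkNorm C p v ≤ b * ‖L v‖ := by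
    refine le_of_forall_gt fun s hs => ?_
    have hs0 : 0 < s := (mul_nonneg hb.le (norm_nonneg _)).trans_lt hs
    refine (funkNorm_lt_iff hC hp hs0).2 (hL _ ?_)
    rwa [map_smul, norm_smul, Real.norm_of_nonneg (inv_nonneg.2 hs0.le), inv_mul_lt_iff₀ hs0,
      ← div_eq_mul_inv, lt_div_iff₀' hb]
  have hneg := hfunk (-u)
  rw [map_neg, norm_neg] at hneg
  rw [finslerNorm_eq hC hp]
  linarith [hfunk u]

lemma bddAbove_dualNorm (hC : IsHilbertDomain C) (hp : p ∈ C)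
    (l : EuclideanSpace ℝ (Fin n) →L[ℝ] ℝ) :
    BddAbove {r : ℝ | ∃ u, finslerNorm C p u = 1 ∧ l u = r} := by
  obtain ⟨R, hR⟩ := hC.bounded.subset_closedBall p
  refine ⟨2 * (‖l‖ * R), ?_⟩
  rintro _ ⟨u, hu, rfl⟩
  have hball (v : EuclideanSpace ℝ (Fin n)) (hv : p + v ∈ C) (_ : p - v ∈ C) :
      ‖l.toLinearMap v‖ ≤ ‖l‖ * R :=
    l.le_opNorm_of_le (by simpa using hR hv)
  have := norm_map_le_mul_finslerNorm hC hp l.toLinearMap (u := u) hball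
  rw [hu, mul_one] at this
  exact (le_abs_self _).trans this

lemma abs_apply_le_dualNorm_mul (hC : IsHilbertDomain C) (hp : p ∈ C)
    (l : EuclideanSpace ℝ (Fin n) →L[ℝ] ℝ) : |l u| ≤ dualNorm C p l * finslerNorm C p u := by
  have hle {v : EuclideanSpace ℝ (Fin n)} (hv : v ≠ 0) :
      l v ≤ dualNorm C p l * finslerNorm C p v := by
    have hF := finslerNorm_pos hC hp hv
    have : l ((finslerNorm C p v)⁻¹ • v) ≤ dualNorm C p l := by
      refine le_csSup (bddAbove_dualNorm hC hp l) ⟨_, ?_, rfl⟩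
      rw [finslerNorm_smul_of_nonneg hC hp (inv_nonneg.2 hF.le), inv_mul_cancel₀ hF.ne']
    rwa [map_smul, smul_eq_mul, inv_mul_le_iff₀ hF, mul_comm] at this
  rcases eq_or_ne u 0 with rfl | hu
  · simp [finslerNorm]
  refine abs_le'.2 ⟨hle hu, ?_⟩
  have := hle (neg_ne_zero.2 hu)
  rwa [map_neg, finslerNorm_neg hC hp] at this

end Finsler

section Busemann

variable {n : ℕ} {C : Set (EuclideanSpace ℝ (Fin n))}

/-- The measure on `C` with density `w` with respect to Lebesgue measure. -/
noncomputable def weightedMeasure (C : Set (EuclideanSpace ℝ (Fin n)))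
    (w : EuclideanSpace ℝ (Fin n) → ℝ) : Measure (EuclideanSpace ℝ (Fin n)) :=
  (volume.restrict C).withDensity fun p => ENNReal.ofReal (w p)

lemma unitBallVolume_ne_zero (n : ℕ) : unitBallVolume n ≠ 0 :=
  (Metric.measure_ball_pos volume _ one_pos).ne'

lemma unitBallVolume_ne_top (n : ℕ) : unitBallVolume n ≠ ∞ :=
  measure_ball_lt_top.ne

lemma unitBallVolume_div_volume_norm_map_lt
    {L : EuclideanSpace ℝ (Fin n) →ₗ[ℝ] EuclideanSpace ℝ (Fin n)} (hL : LinearMap.det L ≠ 0)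
    {r : ℝ} (hr : 0 < r) :
    unitBallVolume n / volume {u | ‖L u‖ < r} = ENNReal.ofReal (|LinearMap.det L| / r ^ n) := by
  have hball : {u | ‖L u‖ < r} = L ⁻¹' Metric.ball 0 r := by ext; simp
  have hpos : 0 < |LinearMap.det L|⁻¹ * r ^ n := by positivity
  rw [hball, Measure.addHaar_preimage_linearMap _ hL, Measure.addHaar_ball_of_pos _ _ hr,
    finrank_euclideanSpace_fin, ← mul_assoc, abs_inv, ← ENNReal.ofReal_mul (by positivity),
    ← unitBallVolume, ENNReal.div_eq_inv_mul,
    ENNReal.mul_inv (.inr (unitBallVolume_ne_top n)) (.inr (unitBallVolume_ne_zero n)), mul_assoc,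
    ENNReal.inv_mul_cancel (unitBallVolume_ne_zero n) (unitBallVolume_ne_top n), mul_one,
    ← ENNReal.ofReal_inv_of_pos hpos, mul_inv, inv_inv, div_eq_mul_inv]

variable {w : EuclideanSpace ℝ (Fin n) → ℝ}
  {L : EuclideanSpace ℝ (Fin n) → EuclideanSpace ℝ (Fin n) →ₗ[ℝ] EuclideanSpace ℝ (Fin n)}

lemma hilbertMeasure_le_smul_weightedMeasure (hC : IsHilbertDomain C) {b : ℝ} (hb : 0 < b)
    (hw : ∀ p ∈ C, 0 < w p) (hdet : ∀ p ∈ C, |LinearMap.det (L p)| = w p)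
    (hL : ∀ p ∈ C, ∀ u, ‖L p u‖ < b⁻¹ → p + u ∈ C) :
    hilbertMeasure C ≤ ENNReal.ofReal (b ^ n) • weightedMeasure C w := by
  rw [weightedMeasure, ← withDensity_smul' _ _ ENNReal.ofReal_ne_top]
  refine withDensity_mono ((ae_restrict_iff' hC.isOpen.measurableSet).2 (.of_forall fun p hp => ?_))
  have hsub : {u | ‖L p u‖ < b⁻¹} ⊆ tangentBall C p := fun u hu =>
    (finslerNorm_le_mul_norm_map hC hp (L p) hb (hL p hp)).trans_lt <| by
      rwa [← lt_inv_mul_iff₀ hb, mul_one]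
  have hdet0 : LinearMap.det (L p) ≠ 0 := abs_pos.1 (hdet p hp ▸ hw p hp)
  calc unitBallVolume n / volume (tangentBall C p)
      ≤ unitBallVolume n / volume {u | ‖L p u‖ < b⁻¹} := by gcongr
    _ = ENNReal.ofReal (b ^ n) * ENNReal.ofReal (w p) := by
      rw [unitBallVolume_div_volume_norm_map_lt hdet0 (inv_pos.2 hb), hdet p hp, inv_pow,
        div_inv_eq_mul, mul_comm, ENNReal.ofReal_mul (by positivity)]

lemma smul_weightedMeasure_le_hilbertMeasure (hC : IsHilbertDomain C) {a : ℝ} (ha : 0 < a)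
    (hw : ∀ p ∈ C, 0 < w p) (hdet : ∀ p ∈ C, |LinearMap.det (L p)| = w p)
    (hL : ∀ p ∈ C, ∀ u, p + u ∈ C → p - u ∈ C → ‖L p u‖ ≤ a) :
    ENNReal.ofReal ((2 * a) ^ n)⁻¹ • weightedMeasure C w ≤ hilbertMeasure C := by
  rw [weightedMeasure, ← withDensity_smul' _ _ ENNReal.ofReal_ne_top]
  refine withDensity_mono ((ae_restrict_iff' hC.isOpen.measurableSet).2 (.of_forall fun p hp => ?_))
  have hsub : tangentBall C p ⊆ {u | ‖L p u‖ < 2 * a} := fun u hu =>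
    (norm_map_le_mul_finslerNorm hC hp (L p) (hL p hp)).trans_lt <|
      mul_lt_of_lt_one_right (by positivity) hu
  have hdet0 : LinearMap.det (L p) ≠ 0 := abs_pos.1 (hdet p hp ▸ hw p hp)
  calc ENNReal.ofReal ((2 * a) ^ n)⁻¹ * ENNReal.ofReal (w p)
      = unitBallVolume n / volume {u | ‖L p u‖ < 2 * a} := by
        rw [unitBallVolume_div_volume_norm_map_lt hdet0 (by positivity), hdet p hp,
          div_eq_inv_mul, ENNReal.ofReal_mul (by positivity)]
    _ ≤ unitBallVolume n / volume (tangentBall C p) := by gcongr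

end Busemann

section Primitive

variable {E : Type*} [NormedAddCommGroup E] [NormedSpace ℝ E]

lemma lipschitzWith_sq_of_abs_le {X : Type*} [PseudoMetricSpace X] {f : X → ℝ} {K M : ℝ≥0}
    (hf : LipschitzWith K f) (hM : ∀ x, |f x| ≤ M) :
    LipschitzWith (2 * M * K) fun x => f x ^ 2 := by
  refine LipschitzWith.of_dist_le_mul fun x y => ?_
  have hsum : |f x + f y| ≤ 2 * M := by linarith [abs_add_le (f x) (f y), hM x, hM y]
  have hdiff : |f x - f y| ≤ K * dist x y := by simpa only [Real.dist_eq] using hf.dist_le_mul x y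
  calc dist (f x ^ 2) (f y ^ 2) = |f x + f y| * |f x - f y| := by
        rw [Real.dist_eq, sq_sub_sq, abs_mul]
    _ ≤ 2 * M * (K * dist x y) := by gcongr
    _ = _ := by push_cast; ring

lemma lineDeriv_sq {f : E → ℝ} {p v : E} (hf : LineDifferentiableAt ℝ f p v) :
    lineDeriv ℝ (fun x => f x ^ 2) p v = 2 * f p * lineDeriv ℝ f p v := by
  have hderiv : HasDerivAt (fun t : ℝ => f (p + t • v)) (lineDeriv ℝ f p v) 0 := hf.hasLineDerivAt
  simpa [lineDeriv] using (hderiv.fun_pow 2).deriv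

lemma exists_contDiff_eventuallyEq_of_isCompact [FiniteDimensional ℝ E] {F : Type*}
    [NormedAddCommGroup F] [NormedSpace ℝ F] {k : ℕ∞} {K Ω : Set E} (hK : IsCompact K)
    (hΩ : IsOpen Ω) (hKΩ : K ⊆ Ω) {Φ : E → F} (hΦ : ContDiffOn ℝ k Φ Ω) :
    ∃ G : E → F, ContDiff ℝ k G ∧ HasCompactSupport G ∧ ∀ p ∈ K, G =ᶠ[𝓝 p] Φ := by
  obtain ⟨L, hL, hKL, hLΩ⟩ := exists_compact_between hK hΩ hKΩ
  obtain ⟨χ, hone, hzero, -⟩ := exists_contMDiffMap_one_nhds_of_subset_interior (n := k)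
    (modelWithCornersSelf ℝ E) hK.isClosed hKL
  have hsub : tsupport χ ⊆ L :=
    closure_minimal (fun x hx => not_imp_comm.1 (hzero x) hx) hL.isClosed
  refine ⟨fun x => χ x • Φ x, contDiff_iff_contDiffAt.2 fun x => ?_,
    HasCompactSupport.smul_right (f := χ) (hL.of_isClosed_subset isClosed_closure hsub),
    fun p hp => ?_⟩
  · by_cases hx : x ∈ tsupport χ
    · exact χ.contMDiff.contDiff.contDiffAt.smul (hΦ.contDiffAt (hΩ.mem_nhds (hLΩ (hsub hx))))
    · refine contDiffAt_const (c := (0 : F)) |>.congr_of_eventuallyEq ?_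
      filter_upwards [notMem_tsupport_iff_eventuallyEq.1 hx] with y hy
      rw [hy, Pi.zero_apply, zero_smul]
  · filter_upwards [hone.filter_mono (nhds_le_nhdsSet hp)] with y hy
    rw [hy, one_smul]

/-- `Φ` is a `C¹` primitive on `C` of the positive function `w` in the direction `e`. Such a pair
yields Hardy and isoperimetric inequalities for the measure of density `w`. -/
structure IsPrimitiveAlong (C : Set E) (e : E) (Φ w : E → ℝ) : Prop where
  contDiffOn : ContDiffOn ℝ 1 Φ C
  hasLineDerivAt : ∀ p ∈ C, HasLineDerivAt ℝ Φ (w p) p e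
  pos : ∀ p ∈ C, 0 < w p

variable {C : Set E} {e : E} {Φ w : E → ℝ}

lemma IsPrimitiveAlong.continuousOn (hΦ : IsPrimitiveAlong C e Φ w) (hC : IsOpen C) :
    ContinuousOn w C := by
  refine ((hΦ.contDiffOn.continuousOn_fderiv_of_isOpen hC le_rfl).clm_apply
    (continuousOn_const (c := e))).congr fun p hp => ?_
  have hd : DifferentiableAt ℝ Φ p :=
    (hΦ.contDiffOn.contDiffAt (hC.mem_nhds hp)).differentiableAt one_ne_zero
  rw [← (hΦ.hasLineDerivAt p hp).lineDeriv, hd.lineDeriv_eq_fderiv]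

variable [FiniteDimensional ℝ E] [MeasurableSpace E] [BorelSpace E] {μ : Measure E}
  [μ.IsAddHaarMeasure]

lemma IsPrimitiveAlong.integral_mul_eq (hΦ : IsPrimitiveAlong C e Φ w) (hC : IsOpen C) {g : E → ℝ}
    {K : ℝ≥0} (hg : LipschitzWith K g) (hgc : HasCompactSupport g) (hgC : tsupport g ⊆ C) :
    ∫ p, g p * w p ∂μ = -∫ p, lineDeriv ℝ g p e * Φ p ∂μ := by
  obtain ⟨G, hG, hGc, hGΦ⟩ :=
    exists_contDiff_eventuallyEq_of_isCompact (k := 1) hgc hC hgC hΦ.contDiffOn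
  obtain ⟨D, hD⟩ := hG.lipschitzWith_of_hasCompactSupport hGc one_ne_zero
  have hw (p : E) : lineDeriv ℝ G p (-e) * g p = -(g p * w p) := by
    by_cases hp : p ∈ tsupport g
    · rw [lineDeriv_neg, (hGΦ p hp).lineDeriv_eq, (hΦ.hasLineDerivAt p (hgC hp)).lineDeriv]
      ring
    · simp [image_eq_zero_of_notMem_tsupport hp]
  have hΦG (p : E) : lineDeriv ℝ g p e * G p = lineDeriv ℝ g p e * Φ p := by
    by_cases hp : p ∈ tsupport g
    · rw [(hGΦ p hp).eq_of_nhds]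
    · have hzero : g =ᶠ[𝓝 p] fun _ => 0 := notMem_tsupport_iff_eventuallyEq.1 hp
      have hderiv : lineDeriv ℝ g p e = 0 := hzero.lineDeriv_eq.trans (by simp [lineDeriv])
      rw [hderiv, zero_mul, zero_mul]
  have hparts := hg.integral_lineDeriv_mul_eq (μ := μ) hD hGc e
  simp only [hw, hΦG, integral_neg] at hparts
  rw [hparts, neg_neg]

end Primitive

section Spectrum

variable {n : ℕ} {C : Set (EuclideanSpace ℝ (Fin n))} {e : EuclideanSpace ℝ (Fin n)}
  {f Φ w : EuclideanSpace ℝ (Fin n) → ℝ}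

lemma IsTestFunction.continuous (hf : IsTestFunction C f) : Continuous f :=
  hf.lipschitz.elim fun _ hK => hK.continuous

lemma IsTestFunction.eq_zero_of_notMem (hf : IsTestFunction C f) {p : EuclideanSpace ℝ (Fin n)}
    (hp : p ∉ C) : f p = 0 :=
  image_eq_zero_of_notMem_tsupport fun h => hp (hf.support_subset h)

lemma lintegral_weightedMeasure (hC : IsOpen C) (hw : ContinuousOn w C)
    (g : EuclideanSpace ℝ (Fin n) → ℝ≥0∞) :
    ∫⁻ p, g p ∂weightedMeasure C w = ∫⁻ p in C, ENNReal.ofReal (w p) * g p :=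
  lintegral_withDensity_eq_lintegral_mul_non_measurable₀ _
    (hw.aemeasurable hC.measurableSet).ennreal_ofReal
    (.of_forall fun _ => ENNReal.ofReal_lt_top) g

lemma IsTestFunction.tsupport_sq_subset (hf : IsTestFunction C f) :
    tsupport (fun p => f p ^ 2) ⊆ C :=
  (tsupport_comp_subset (g := fun t : ℝ => t ^ 2) (by simp) f).trans hf.support_subset

lemma IsTestFunction.continuous_sq_mul (hf : IsTestFunction C f) (hC : IsOpen C)
    (hw : ContinuousOn w C) : Continuous fun p => f p ^ 2 * w p :=
  ((hf.continuous.pow 2).continuousOn.mul hw).continuous_of_tsupport_subset hC <|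
    tsupport_mul_subset_left.trans hf.tsupport_sq_subset

lemma IsTestFunction.hasCompactSupport_sq_mul (hf : IsTestFunction C f) :
    HasCompactSupport fun p => f p ^ 2 * w p :=
  hf.compactSupport.mono fun p hp h => hp (by simp [h])

lemma IsTestFunction.sq_mul_nonneg (hf : IsTestFunction C f) (hw : ∀ p ∈ C, 0 < w p)
    (p : EuclideanSpace ℝ (Fin n)) : 0 ≤ f p ^ 2 * w p := by
  by_cases hp : p ∈ C
  · exact mul_nonneg (sq_nonneg _) (hw p hp).le
  · simp [hf.eq_zero_of_notMem hp]

lemma IsTestFunction.lintegral_sq_weightedMeasure (hf : IsTestFunction C f) (hC : IsOpen C)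
    (hwc : ContinuousOn w C) (hw : ∀ p ∈ C, 0 < w p) :
    ∫⁻ p, ENNReal.ofReal (f p ^ 2) ∂weightedMeasure C w =
      ENNReal.ofReal (∫ p, f p ^ 2 * w p) := by
  have hint : Integrable fun p => f p ^ 2 * w p :=
    (hf.continuous_sq_mul hC hwc).integrable_of_hasCompactSupport hf.hasCompactSupport_sq_mul
  have hsupp : Function.support (fun p => ENNReal.ofReal (f p ^ 2 * w p)) ⊆ C := fun p hp => by
    by_contra h
    simp [hf.eq_zero_of_notMem h] at hp
  rw [ofReal_integral_eq_lintegral_ofReal hint (.of_forall (hf.sq_mul_nonneg hw)),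
    ← setLIntegral_eq_of_support_subset hsupp, lintegral_weightedMeasure hC hwc]
  exact lintegral_congr fun p => by rw [ENNReal.ofReal_mul (sq_nonneg _), mul_comm]

lemma IsTestFunction.integral_sq_mul_pos (hf : IsTestFunction C f) (hC : IsOpen C)
    (hwc : ContinuousOn w C) (hw : ∀ p ∈ C, 0 < w p) : 0 < ∫ p, f p ^ 2 * w p := by
  obtain ⟨p, hp⟩ := Function.ne_iff.1 hf.ne_zero
  have hpC : p ∈ C := by_contra fun h => hp (hf.eq_zero_of_notMem h)
  exact (hf.continuous_sq_mul hC hwc).integral_pos_of_hasCompactSupport_nonneg_nonzero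
    hf.hasCompactSupport_sq_mul (hf.sq_mul_nonneg hw)
    (mul_ne_zero (pow_ne_zero 2 hp) (hw p hpC).ne')

lemma IsPrimitiveAlong.integral_sq_mul_eq (hΦ : IsPrimitiveAlong C e Φ w) (hC : IsOpen C)
    (hf : IsTestFunction C f) :
    ∫ p, f p ^ 2 * w p = -∫ p, 2 * f p * (lineDeriv ℝ f p e * Φ p) := by
  obtain ⟨K, hK⟩ := hf.lipschitz
  obtain ⟨M, hM⟩ := hf.compactSupport.exists_bound_of_continuous hK.continuous
  have hsq : LipschitzWith (2 * M.toNNReal * K) fun p => f p ^ 2 :=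
    lipschitzWith_sq_of_abs_le hK fun x => (hM x).trans (Real.le_coe_toNNReal M)
  have hsupp : HasCompactSupport fun p => f p ^ 2 :=
    hf.compactSupport.comp_left (g := fun t : ℝ => t ^ 2) (by simp)
  rw [hΦ.integral_mul_eq hC hsq hsupp hf.tsupport_sq_subset, neg_inj]
  refine integral_congr_ae ?_
  filter_upwards [hK.ae_differentiableAt] with p hp
  rw [lineDeriv_sq hp.lineDifferentiableAt, mul_assoc]

lemma enorm_two_mul_mul_le {x y w : ℝ} (hw : 0 < w) :
    ‖2 * x * y‖ₑ ≤ 2⁻¹ * (ENNReal.ofReal w * ENNReal.ofReal (x ^ 2)) +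
      2 * ENNReal.ofReal (y ^ 2 / w) := by
  have hreal : |2 * x * y| ≤ 2⁻¹ * (w * x ^ 2) + 2 * (y ^ 2 / w) := by
    obtain ⟨z, rfl⟩ : ∃ z, y = z * w := ⟨y / w, by field_simp⟩
    have hdiv : (z * w) ^ 2 / w = z ^ 2 * w := by field_simp
    rw [hdiv, abs_le]
    constructor <;> nlinarith [mul_nonneg hw.le (sq_nonneg (x - 2 * z)),
      mul_nonneg hw.le (sq_nonneg (x + 2 * z))]
  have htwo : (2 : ℝ≥0∞) = ENNReal.ofReal 2 := by simp
  rw [Real.enorm_eq_ofReal_abs, ← ENNReal.ofReal_mul hw.le, htwo,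
    ← ENNReal.ofReal_inv_of_pos two_pos, ← ENNReal.ofReal_mul (by positivity),
    ← ENNReal.ofReal_mul (by positivity), ← ENNReal.ofReal_add (by positivity) (by positivity)]
  exact ENNReal.ofReal_le_ofReal hreal

/-- Hardy's inequality for a weight with a primitive, by Cauchy-Schwarz after an integration by
parts. -/
lemma IsPrimitiveAlong.lintegral_sq_le (hΦ : IsPrimitiveAlong C e Φ w) (hC : IsOpen C)
    (hf : IsTestFunction C f) :
    ∫⁻ p, ENNReal.ofReal (f p ^ 2) ∂weightedMeasure C w ≤
      4 * ∫⁻ p in C, ENNReal.ofReal ((lineDeriv ℝ f p e * Φ p) ^ 2 / w p) := by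
  have hwc := hΦ.continuousOn hC
  set I := ∫⁻ p, ENNReal.ofReal (f p ^ 2) ∂weightedMeasure C w with hI
  set J := ∫⁻ p in C, ENNReal.ofReal ((lineDeriv ℝ f p e * Φ p) ^ 2 / w p) with hJ
  have hIeq : I = ENNReal.ofReal (∫ p, f p ^ 2 * w p) :=
    hf.lintegral_sq_weightedMeasure hC hwc hΦ.pos
  have hsupp : Function.support (fun p => ‖2 * f p * (lineDeriv ℝ f p e * Φ p)‖ₑ) ⊆ C :=
    fun p hp => by
      by_contra h
      simp [hf.eq_zero_of_notMem h] at hp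
  have hmeas : AEMeasurable (fun p => ENNReal.ofReal (w p) * ENNReal.ofReal (f p ^ 2))
      (volume.restrict C) :=
    (hwc.aemeasurable hC.measurableSet).ennreal_ofReal.mul
      (hf.continuous.measurable.pow_const 2).ennreal_ofReal.aemeasurable
  have hle : I ≤ 2⁻¹ * I + 2 * J :=
    calc I ≤ ‖∫ p, 2 * f p * (lineDeriv ℝ f p e * Φ p)‖ₑ := by
          rw [hIeq, hΦ.integral_sq_mul_eq hC hf, ← enorm_neg]
          exact Real.ofReal_le_enorm _
      _ ≤ ∫⁻ p, ‖2 * f p * (lineDeriv ℝ f p e * Φ p)‖ₑ := enorm_integral_le_lintegral_enorm _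
      _ = ∫⁻ p in C, ‖2 * f p * (lineDeriv ℝ f p e * Φ p)‖ₑ :=
          (setLIntegral_eq_of_support_subset hsupp).symm
      _ ≤ ∫⁻ p in C, (2⁻¹ * (ENNReal.ofReal (w p) * ENNReal.ofReal (f p ^ 2)) +
            2 * ENNReal.ofReal ((lineDeriv ℝ f p e * Φ p) ^ 2 / w p)) :=
          setLIntegral_mono' hC.measurableSet fun p hp => enorm_two_mul_mul_le (hΦ.pos p hp)
      _ = 2⁻¹ * I + 2 * J := by
          rw [lintegral_add_left' (hmeas.const_mul _), lintegral_const_mul' _ _ (by simp),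
            lintegral_const_mul' _ _ (by simp), hI, hJ, lintegral_weightedMeasure hC hwc]
  have hhalf : 2⁻¹ * I ≠ ∞ := ENNReal.mul_ne_top (by simp) (hIeq ▸ ENNReal.ofReal_ne_top)
  have hsplit : 2⁻¹ * I + 2⁻¹ * I ≤ 2⁻¹ * I + 2 * J := by
    rwa [← add_mul, ENNReal.inv_two_add_inv_two, one_mul]
  calc I = 2 * (2⁻¹ * I) := by
        rw [← mul_assoc, ENNReal.mul_inv_cancel (by simp) (by simp), one_mul]
    _ ≤ 2 * (2 * J) := mul_le_mul' le_rfl ((ENNReal.add_le_add_iff_left hhalf).1 hsplit)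
    _ = 4 * J := by rw [← mul_assoc]; norm_num

lemma lineDeriv_mul_sq_div_le (hC : IsHilbertDomain C) {p : EuclideanSpace ℝ (Fin n)} (hp : p ∈ C)
    (hf : DifferentiableAt ℝ f p) (hw : 0 < w p) {A : ℝ}
    (hA : |Φ p| * finslerNorm C p e ≤ A * w p) :
    (lineDeriv ℝ f p e * Φ p) ^ 2 / w p ≤ A ^ 2 * (w p * dualNorm C p (fderiv ℝ f p) ^ 2) := by
  set N := dualNorm C p (fderiv ℝ f p)
  have hderiv : |fderiv ℝ f p e * Φ p| ≤ |N * (|Φ p| * finslerNorm C p e)| := by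
    rw [abs_mul]
    calc |fderiv ℝ f p e| * |Φ p| ≤ N * finslerNorm C p e * |Φ p| := by
          gcongr
          exact abs_apply_le_dualNorm_mul hC hp (fderiv ℝ f p)
      _ = N * (|Φ p| * finslerNorm C p e) := by ring
      _ ≤ _ := le_abs_self _
  have hF : 0 ≤ |Φ p| * finslerNorm C p e := mul_nonneg (abs_nonneg _) (finslerNorm_nonneg hC hp)
  rw [hf.lineDeriv_eq_fderiv, div_le_iff₀ hw]
  calc (fderiv ℝ f p e * Φ p) ^ 2 ≤ N ^ 2 * (|Φ p| * finslerNorm C p e) ^ 2 := by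
        rw [← mul_pow]
        exact sq_le_sq.2 hderiv
    _ ≤ N ^ 2 * (A * w p) ^ 2 := by gcongr
    _ = A ^ 2 * (w p * N ^ 2) * w p := by ring

lemma IsPrimitiveAlong.lintegral_sq_le_lintegral_dualNorm (hΦ : IsPrimitiveAlong C e Φ w)
    (hC : IsHilbertDomain C) {A : ℝ} (hA : ∀ p ∈ C, |Φ p| * finslerNorm C p e ≤ A * w p)
    (hf : IsTestFunction C f) :
    ∫⁻ p, ENNReal.ofReal (f p ^ 2) ∂weightedMeasure C w ≤
      4 * ENNReal.ofReal (A ^ 2) *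
        ∫⁻ p, ENNReal.ofReal (dualNorm C p (fderiv ℝ f p) ^ 2) ∂weightedMeasure C w := by
  obtain ⟨K, hK⟩ := hf.lipschitz
  refine (hΦ.lintegral_sq_le hC.isOpen hf).trans ?_
  rw [mul_assoc, lintegral_weightedMeasure hC.isOpen (hΦ.continuousOn hC.isOpen),
    ← lintegral_const_mul' _ _ ENNReal.ofReal_ne_top]
  gcongr 4 * ?_
  refine lintegral_mono_ae ?_
  filter_upwards [ae_restrict_mem hC.isOpen.measurableSet,
    ae_restrict_of_ae hK.ae_differentiableAt] with p hp hd
  rw [← ENNReal.ofReal_mul (hΦ.pos p hp).le, ← ENNReal.ofReal_mul (sq_nonneg A)]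
  exact ENNReal.ofReal_le_ofReal (lineDeriv_mul_sq_div_le hC hp hd (hΦ.pos p hp) (hA p hp))

lemma bottomOfSpectrum_pos (hC : IsHilbertDomain C) (hΦ : IsPrimitiveAlong C e Φ w) {A : ℝ}
    (hA : ∀ p ∈ C, |Φ p| * finslerNorm C p e ≤ A * w p) {α β : ℝ≥0∞} (hα : α ≠ 0) (hβ : β ≠ ∞)
    (hle : α • weightedMeasure C w ≤ hilbertMeasure C)
    (hge : hilbertMeasure C ≤ β • weightedMeasure C w) : 0 < bottomOfSpectrum C := by
  have hwc := hΦ.continuousOn hC.isOpen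
  set c : ℝ≥0∞ := α / (β * (4 * ENNReal.ofReal (A ^ 2)))
  have hc : 0 < c := ENNReal.div_pos hα (ENNReal.mul_ne_top hβ (by finiteness))
  refine hc.trans_le (le_iInf₂ fun f hf => ?_)
  set I := ∫⁻ p, ENNReal.ofReal (f p ^ 2) ∂weightedMeasure C w with hI
  set J := ∫⁻ p, ENNReal.ofReal (dualNorm C p (fderiv ℝ f p) ^ 2) ∂weightedMeasure C w with hJ
  have hIeq : I = ENNReal.ofReal (∫ p, f p ^ 2 * w p) :=
    hf.lintegral_sq_weightedMeasure hC.isOpen hwc hΦ.pos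
  have hI0 : I ≠ 0 := by
    rw [hIeq]
    exact (ENNReal.ofReal_pos.2 (hf.integral_sq_mul_pos hC.isOpen hwc hΦ.pos)).ne'
  have hIfin : I ≠ ∞ := hIeq ▸ ENNReal.ofReal_ne_top
  have hIJ : I ≤ 4 * ENNReal.ofReal (A ^ 2) * J := hΦ.lintegral_sq_le_lintegral_dualNorm hC hA hf
  have hnum : α * J ≤ ∫⁻ p, ENNReal.ofReal (dualNorm C p (fderiv ℝ f p) ^ 2) ∂hilbertMeasure C := by
    rw [hJ, ← smul_eq_mul, ← lintegral_smul_measure]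
    exact lintegral_mono' hle le_rfl
  have hden : ∫⁻ p, ENNReal.ofReal (f p ^ 2) ∂hilbertMeasure C ≤ β * I := by
    rw [hI, ← smul_eq_mul, ← lintegral_smul_measure]
    exact lintegral_mono' hge le_rfl
  have hJ0 : J ≠ 0 := fun h => hI0 (le_zero_iff.1 (by simpa [h] using hIJ))
  have hnum0 := (pos_iff_ne_zero.2 (mul_ne_zero hα hJ0)).trans_le hnum
  rw [rayleighQuotient, ENNReal.le_div_iff_mul_le (.inr hnum0.ne')
    (.inl (hden.trans_lt (ENNReal.mul_lt_top hβ.lt_top hIfin.lt_top)).ne)]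
  calc c * ∫⁻ p, ENNReal.ofReal (f p ^ 2) ∂hilbertMeasure C
      ≤ c * (β * (4 * ENNReal.ofReal (A ^ 2) * J)) := by gcongr; exact hden.trans (by gcongr)
    _ = β * (4 * ENNReal.ofReal (A ^ 2)) * c * J := by ring
    _ ≤ α * J := by gcongr; exact ENNReal.mul_div_le
    _ ≤ _ := hnum

end Spectrum

section Cheeger

lemma mem_frontier_of_isLUB {α : Type*} [TopologicalSpace α] [LinearOrder α] [OrderTopology α]
    [DenselyOrdered α] [NoMaxOrder α] {V : Set α} {a : α} (hV : IsOpen V) (hne : V.Nonempty)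
    (ha : IsLUB V a) : a ∈ frontier V := by
  refine hV.frontier_eq ▸ ⟨ha.mem_closure hne, fun haV => ?_⟩
  have hright : ∀ᶠ b in 𝓝[>] a, b ∈ V := nhdsWithin_le_nhds (hV.mem_nhds haV)
  obtain ⟨b, hbV, hab⟩ := (hright.and self_mem_nhdsWithin).exists
  exact (ha.1 hbV).not_gt hab

lemma mem_frontier_of_isGLB {α : Type*} [TopologicalSpace α] [LinearOrder α] [OrderTopology α]
    [DenselyOrdered α] [NoMinOrder α] {V : Set α} {a : α} (hV : IsOpen V) (hne : V.Nonempty)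
    (ha : IsGLB V a) : a ∈ frontier V :=
  mem_frontier_of_isLUB (α := αᵒᵈ) hV hne ha

lemma lintegral_Icc_le_of_hasDerivAt {φ ω : ℝ → ℝ} {a b : ℝ} (hab : a ≤ b)
    (hφ : ∀ x ∈ Set.Icc a b, HasDerivAt φ (ω x) x) (hω : ContinuousOn ω (Set.Icc a b))
    (hω0 : ∀ x ∈ Set.Icc a b, 0 ≤ ω x) :
    ∫⁻ x in Set.Icc a b, ENNReal.ofReal (ω x) ≤
      ENNReal.ofReal |φ b| + ENNReal.ofReal |φ a| := by
  rw [← Set.uIcc_of_le hab] at hφ hω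
  have hftc := intervalIntegral.integral_eq_sub_of_hasDerivAt hφ hω.intervalIntegrable
  rw [intervalIntegral.integral_of_le hab, ← integral_Icc_eq_integral_Ioc] at hftc
  rw [Set.uIcc_of_le hab] at hω
  rw [← ofReal_integral_eq_lintegral_ofReal (hω.integrableOn_Icc)
      ((ae_restrict_iff' measurableSet_Icc).2 (.of_forall hω0)),
    hftc, ← ENNReal.ofReal_add (abs_nonneg _) (abs_nonneg _)]
  exact ENNReal.ofReal_le_ofReal ((le_abs_self _).trans (abs_sub _ _))

variable {n : ℕ} {C U : Set (EuclideanSpace ℝ (Fin (n + 1)))}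

/-- The point of `ℝⁿ⁺¹` with first coordinate `x` and remaining coordinates `y`. -/
def consPoint (x : ℝ) (y : Fin n → ℝ) : EuclideanSpace ℝ (Fin (n + 1)) :=
  WithLp.toLp 2 (Fin.cons x y)

/-- The projection of `ℝⁿ⁺¹` along the first axis. -/
def tailPoint (p : EuclideanSpace ℝ (Fin (n + 1))) : Fin n → ℝ :=
  Fin.tail p.ofLp

lemma tailPoint_consPoint (x : ℝ) (y : Fin n → ℝ) : tailPoint (consPoint x y) = y :=
  Fin.tail_cons (α := fun _ => ℝ) x y

lemma consPoint_add_smul_single (x t : ℝ) (y : Fin n → ℝ) :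
    consPoint x y + t • EuclideanSpace.single 0 1 = consPoint (x + t) y := by
  ext i
  cases i using Fin.cases <;> simp [consPoint]

lemma continuous_consPoint (y : Fin n → ℝ) : Continuous fun x => consPoint x y := by
  refine (PiLp.continuous_toLp 2 _).comp (continuous_pi fun i => ?_)
  cases i using Fin.cases
  · exact continuous_id
  · exact continuous_const

lemma consPoint_mem_of_mem_Icc (hC : Convex ℝ C) {y : Fin n → ℝ} {a b x : ℝ}
    (ha : consPoint a y ∈ C) (hb : consPoint b y ∈ C) (hx : x ∈ Set.Icc a b) :
    consPoint x y ∈ C := by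
  have hconvex : Convex ℝ {x | consPoint x y ∈ C} := by
    have hpre := (hC.translate_preimage_right (consPoint 0 y)).linear_preimage
      (LinearMap.toSpanSingleton ℝ _ (EuclideanSpace.single (0 : Fin (n + 1)) (1 : ℝ)))
    simpa [Set.preimage, consPoint_add_smul_single] using hpre
  exact hconvex.ordConnected.out ha hb hx

lemma lintegral_eq_lintegral_consPoint {g : EuclideanSpace ℝ (Fin (n + 1)) → ℝ≥0∞}
    (hg : AEMeasurable g) : ∫⁻ p, g p = ∫⁻ y, ∫⁻ x, g (consPoint x y) := by
  have hmp := (PiLp.volume_preserving_toLp (Fin (n + 1))).comp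
    (volume_preserving_piFinSuccAbove (fun _ : Fin (n + 1) => ℝ) 0).symm
  rw [← hmp.lintegral_comp_emb ((MeasurableEquiv.toLp 2 _).measurableEmbedding.comp
      (MeasurableEquiv.measurableEmbedding _)), Measure.volume_eq_prod, lintegral_prod_symm]
  · simp [consPoint, Fin.consEquiv]
  · exact hg.comp_quasiMeasurePreserving hmp.quasiMeasurePreserving

variable {Φ w : EuclideanSpace ℝ (Fin (n + 1)) → ℝ}

lemma IsPrimitiveAlong.hasDerivAt_consPoint
    (hΦ : IsPrimitiveAlong C (EuclideanSpace.single 0 1) Φ w) {x : ℝ} {y : Fin n → ℝ}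
    (h : consPoint x y ∈ C) : HasDerivAt (fun x => Φ (consPoint x y)) (w (consPoint x y)) x := by
  have hline : HasDerivAt (fun t : ℝ => Φ (consPoint x y + t • EuclideanSpace.single 0 1))
      (w (consPoint x y)) (x - x) := by
    rw [sub_self]
    exact hΦ.hasLineDerivAt _ h
  simpa only [consPoint_add_smul_single, add_sub_cancel] using hline.comp_sub_const x x

/-- The line meets `U` between two of its boundary points, and the weight integrates to the
variation of its primitive. -/
lemma IsPrimitiveAlong.lintegral_preimage_consPoint_le
    (hΦ : IsPrimitiveAlong C (EuclideanSpace.single 0 1) Φ w) (hC : IsOpen C)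
    (hconv : Convex ℝ C) (hU : IsOpen U) (hUc : IsCompact (closure U)) (hUC : closure U ⊆ C)
    {F : (Fin n → ℝ) → ℝ≥0∞} (hF : ∀ q ∈ frontier U, ENNReal.ofReal |Φ q| ≤ F (tailPoint q))
    (y : Fin n → ℝ) :
    ∫⁻ x in (consPoint · y) ⁻¹' U, ENNReal.ofReal (w (consPoint x y)) ≤ 2 * F y := by
  have hcons := continuous_consPoint y
  set V : Set ℝ := (consPoint · y) ⁻¹' U
  rcases V.eq_empty_or_nonempty with hempty | hne
  · simp [hempty]
  have hV : IsOpen V := hU.preimage hcons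
  have hbdd : Bornology.IsBounded V := by
    refine (hUc.image (f := fun p => p 0) (by fun_prop)).isBounded.subset fun x hx => ?_
    exact ⟨consPoint x y, subset_closure hx, rfl⟩
  have hfrontier {x : ℝ} (hx : x ∈ frontier V) : consPoint x y ∈ frontier U :=
    hcons.frontier_preimage_subset U hx
  have hinf := hfrontier (mem_frontier_of_isGLB hV hne (isGLB_csInf hne hbdd.bddBelow))
  have hsup := hfrontier (mem_frontier_of_isLUB hV hne (isLUB_csSup hne hbdd.bddAbove))
  have hmem {x : ℝ} (hx : x ∈ Set.Icc (sInf V) (sSup V)) : consPoint x y ∈ C :=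
    consPoint_mem_of_mem_Icc hconv (hUC (frontier_subset_closure hinf))
      (hUC (frontier_subset_closure hsup)) hx
  calc ∫⁻ x in V, ENNReal.ofReal (w (consPoint x y))
      ≤ ∫⁻ x in Set.Icc (sInf V) (sSup V), ENNReal.ofReal (w (consPoint x y)) :=
        lintegral_mono_set (Bornology.IsBounded.subset_Icc_sInf_sSup hbdd)
    _ ≤ ENNReal.ofReal |Φ (consPoint (sSup V) y)| + ENNReal.ofReal |Φ (consPoint (sInf V) y)| :=
        lintegral_Icc_le_of_hasDerivAt (csInf_le_csSup hne hbdd.bddBelow hbdd.bddAbove)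
          (fun x hx => hΦ.hasDerivAt_consPoint (hmem hx))
          ((hΦ.continuousOn hC).comp hcons.continuousOn fun x hx => hmem hx)
          fun x hx => (hΦ.pos _ (hmem hx)).le
    _ ≤ F y + F y := by
        simpa only [tailPoint_consPoint] using add_le_add (hF _ hsup) (hF _ hinf)
    _ = 2 * F y := (two_mul _).symm

lemma weightedMeasure_apply (hU : MeasurableSet U) (hUC : U ⊆ C) :
    weightedMeasure C w U = ∫⁻ p in U, ENNReal.ofReal (w p) := by
  rw [weightedMeasure, withDensity_apply _ hU, Measure.restrict_restrict hU,
    Set.inter_eq_left.2 hUC]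

lemma IsPrimitiveAlong.weightedMeasure_le
    (hΦ : IsPrimitiveAlong C (EuclideanSpace.single 0 1) Φ w) (hC : IsOpen C)
    (hconv : Convex ℝ C) (hU : IsOpen U) (hUc : IsCompact (closure U)) (hUC : closure U ⊆ C)
    {F : (Fin n → ℝ) → ℝ≥0∞} (hF : ∀ q ∈ frontier U, ENNReal.ofReal |Φ q| ≤ F (tailPoint q)) :
    weightedMeasure C w U ≤ 2 * ∫⁻ y, F y := by
  have hsub : U ⊆ C := subset_closure.trans hUC
  have hmeas : AEMeasurable (U.indicator fun p => ENNReal.ofReal (w p)) :=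
    (aemeasurable_indicator_iff hU.measurableSet).2
      (((hΦ.continuousOn hC).mono hsub).aemeasurable hU.measurableSet).ennreal_ofReal
  rw [weightedMeasure_apply hU.measurableSet hsub, ← lintegral_indicator hU.measurableSet,
    lintegral_eq_lintegral_consPoint hmeas, ← lintegral_const_mul' _ _ ENNReal.ofNat_ne_top]
  refine lintegral_mono fun y => ?_
  exact (lintegral_indicator (hU.preimage (continuous_consPoint y)).measurableSet _).trans_le
    (hΦ.lintegral_preimage_consPoint_le hC hconv hU hUc hUC hF y)

lemma IsPrimitiveAlong.weightedMeasure_le_tsum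
    (hΦ : IsPrimitiveAlong C (EuclideanSpace.single 0 1) Φ w) (hC : IsOpen C)
    (hconv : Convex ℝ C) (hU : IsOpen U) (hUc : IsCompact (closure U)) (hUC : closure U ⊆ C)
    {t : ℕ → Set (EuclideanSpace ℝ (Fin (n + 1)))} (ht : frontier U ⊆ ⋃ i, t i) :
    weightedMeasure C w U ≤
      2 * ∑' i, (⨆ q ∈ t i, ENNReal.ofReal |Φ q|) * volume (tailPoint '' t i) := by
  set F : ℕ → (Fin n → ℝ) → ℝ≥0∞ := fun i =>
    (toMeasurable volume (tailPoint '' t i)).indicator fun _ => ⨆ q ∈ t i, ENNReal.ofReal |Φ q|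
  have hFm (i : ℕ) : Measurable (F i) :=
    measurable_const.indicator (measurableSet_toMeasurable _ _)
  have hF : ∀ q ∈ frontier U, ENNReal.ofReal |Φ q| ≤ ∑' i, F i (tailPoint q) := fun q hq => by
    obtain ⟨i, hi⟩ := Set.mem_iUnion.1 (ht hq)
    have hFi : F i (tailPoint q) = ⨆ q ∈ t i, ENNReal.ofReal |Φ q| :=
      Set.indicator_of_mem (subset_toMeasurable _ _ (Set.mem_image_of_mem _ hi)) _
    exact ((le_iSup₂ (f := fun q _ => ENNReal.ofReal |Φ q|) q hi).trans_eq hFi.symm).trans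
      (ENNReal.le_tsum i)
  refine (hΦ.weightedMeasure_le hC hconv hU hUc hUC (F := fun y => ∑' i, F i y) hF).trans_eq ?_
  rw [lintegral_tsum fun i => (hFm i).aemeasurable]
  simp only [F, lintegral_indicator_const (measurableSet_toMeasurable _ _), measure_toMeasurable]

lemma weightedMeasure_ne_zero (hC : IsOpen C) (hw : ContinuousOn w C) (hw0 : ∀ p ∈ C, 0 < w p)
    (hU : IsOpen U) (hne : U.Nonempty) (hUC : U ⊆ C) : weightedMeasure C w U ≠ 0 := by
  have hac : volume.restrict C ≪ weightedMeasure C w :=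
    withDensity_absolutelyContinuous' (hw.aemeasurable hC.measurableSet).ennreal_ofReal <|
      (ae_restrict_iff' hC.measurableSet).2 <| .of_forall fun p hp =>
        (ENNReal.ofReal_pos.2 (hw0 p hp)).ne'
  intro hzero
  refine (hU.measure_pos volume hne).ne' ?_
  rw [← Measure.restrict_eq_self volume hUC]
  exact hac hzero

lemma weightedMeasure_ne_top (hw : ContinuousOn w C) (hU : MeasurableSet U)
    (hUc : IsCompact (closure U)) (hUC : closure U ⊆ C) : weightedMeasure C w U ≠ ∞ := by
  rw [weightedMeasure_apply hU (subset_closure.trans hUC)]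
  exact (((hw.mono hUC).integrableOn_compact hUc).mono_set subset_closure).lintegral_lt_top.ne

lemma IsPrimitiveAlong.le_hilbertHausdorff
    (hΦ : IsPrimitiveAlong C (EuclideanSpace.single 0 1) Φ w) (hC : IsOpen C)
    (hconv : Convex ℝ C) (hU : IsOpen U) (hUc : IsCompact (closure U)) (hUC : closure U ⊆ C)
    {r A : ℝ≥0∞} (hr : 0 < r)
    (hA : ∀ t ⊆ C, t.Nonempty → hilbertDiam C t ≤ r →
      (⨆ q ∈ t, ENNReal.ofReal |Φ q|) * volume (tailPoint '' t) ≤ A * hilbertDiam C t ^ n) :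
    unitBallVolume n / 2 ^ n * (weightedMeasure C w U / (2 * A)) ≤
      hilbertHausdorff C n (frontier U) := by
  rw [hilbertHausdorff]
  gcongr
  refine le_iSup₂_of_le r hr (le_iInf₂ fun t ⟨htC, hcover, hdiam⟩ => ?_)
  refine ENNReal.div_le_of_le_mul' <|
    (hΦ.weightedMeasure_le_tsum hC hconv hU hUc hUC hcover).trans ?_
  rw [mul_assoc, ← ENNReal.tsum_mul_left (a := A)]
  gcongr 2 * ∑' i, ?_ with i
  rcases (t i).eq_empty_or_nonempty with hempty | hne
  · simp [hempty]
  · simpa [hne] using hA (t i) (htC i) hne (hdiam i)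

lemma cheegerConstant_pos (hC : IsOpen C) (hconv : Convex ℝ C)
    (hΦ : IsPrimitiveAlong C (EuclideanSpace.single 0 1) Φ w) {r A β : ℝ≥0∞} (hr : 0 < r)
    (hAtop : A ≠ ∞) (hβ : β ≠ ∞) (hge : hilbertMeasure C ≤ β • weightedMeasure C w)
    (hA : ∀ t ⊆ C, t.Nonempty → hilbertDiam C t ≤ r →
      (⨆ q ∈ t, ENNReal.ofReal |Φ q|) * volume (tailPoint '' t) ≤ A * hilbertDiam C t ^ n) :
    0 < cheegerConstant C := by
  have hwc := hΦ.continuousOn hC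
  set κ : ℝ≥0∞ := unitBallVolume n / 2 ^ n / (2 * A) with hκ
  have hκ0 : κ ≠ 0 := ENNReal.div_ne_zero.2 ⟨ENNReal.div_ne_zero.2
    ⟨unitBallVolume_ne_zero n, by finiteness⟩, by finiteness⟩
  refine (ENNReal.div_pos hκ0 hβ).trans_le (le_iInf₂ fun U hU => ?_)
  set m := weightedMeasure C w U
  have hm0 : m ≠ 0 := weightedMeasure_ne_zero hC hwc hΦ.pos hU.isOpen hU.nonempty
    (subset_closure.trans hU.closure_subset)
  have hmtop : m ≠ ∞ := weightedMeasure_ne_top hwc hU.isOpen.measurableSet hU.compact_closure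
    hU.closure_subset
  have hnum : κ * m ≤ hilbertHausdorff C n (frontier U) := by
    rw [hκ, ENNReal.mul_comm_div]
    exact hΦ.le_hilbertHausdorff hC hconv hU.isOpen hU.compact_closure hU.closure_subset hr hA
  calc κ / β = κ * m / (β * m) := (ENNReal.mul_div_mul_right _ _ hm0 hmtop).symm
    _ ≤ hilbertHausdorff C n (frontier U) / hilbertMeasure C U := ENNReal.div_le_div hnum (hge U)

end Cheeger

section Cylinder

/-- The defining function `1 - x² - y²` of the round side of the cylinder. -/
def radialGap (p : EuclideanSpace ℝ (Fin 3)) : ℝ := 1 - p 0 ^ 2 - p 1 ^ 2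

/-- The square `1 - y²` of half the length of the chord of the cylinder through `p` parallel to the
first axis. -/
def chordGap (p : EuclideanSpace ℝ (Fin 3)) : ℝ := 1 - p 1 ^ 2

/-- The defining function `1 - z²` of the two flat sides of the cylinder. -/
def heightGap (p : EuclideanSpace ℝ (Fin 3)) : ℝ := 1 - p 2 ^ 2

variable {p q u : EuclideanSpace ℝ (Fin 3)}

lemma mem_cylinder_iff : p ∈ cylinder ↔ 0 < radialGap p ∧ 0 < heightGap p := by
  rw [cylinder, Set.mem_ofPred_eq, ← sq_lt_one_iff_abs_lt_one, radialGap, heightGap, sub_sub,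
    sub_pos, sub_pos]

lemma radialGap_pos (hp : p ∈ cylinder) : 0 < radialGap p := (mem_cylinder_iff.1 hp).1

lemma heightGap_pos (hp : p ∈ cylinder) : 0 < heightGap p := (mem_cylinder_iff.1 hp).2

lemma chordGap_eq (p : EuclideanSpace ℝ (Fin 3)) : chordGap p = radialGap p + p 0 ^ 2 := by
  unfold chordGap radialGap
  ring

lemma chordGap_pos (hp : p ∈ cylinder) : 0 < chordGap p := by
  rw [chordGap_eq]
  exact add_pos_of_pos_of_nonneg (radialGap_pos hp) (sq_nonneg _)

lemma convexOn_coord_sq (i : Fin 3) :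
    ConvexOn ℝ Set.univ fun p : EuclideanSpace ℝ (Fin 3) => p i ^ 2 :=
  (even_two.convexOn_pow (𝕜 := ℝ)).comp_linearMap
    (EuclideanSpace.proj i : EuclideanSpace ℝ (Fin 3) →L[ℝ] ℝ).toLinearMap

lemma concaveOn_chordGap : ConcaveOn ℝ Set.univ chordGap :=
  (concaveOn_const 1 convex_univ).sub (convexOn_coord_sq 1)

lemma concaveOn_heightGap : ConcaveOn ℝ Set.univ heightGap :=
  (concaveOn_const 1 convex_univ).sub (convexOn_coord_sq 2)

lemma concaveOn_radialGap : ConcaveOn ℝ Set.univ radialGap :=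
  ((concaveOn_const 1 convex_univ).sub (convexOn_coord_sq 0)).sub (convexOn_coord_sq 1)

lemma cylinder_eq_inter : cylinder = {p | 0 < radialGap p} ∩ {p | 0 < heightGap p} :=
  Set.ext fun _ => mem_cylinder_iff

lemma isOpen_cylinder : IsOpen cylinder := by
  have hr : Continuous radialGap := by unfold radialGap; fun_prop
  have hh : Continuous heightGap := by unfold heightGap; fun_prop
  rw [cylinder_eq_inter]
  exact (isOpen_lt continuous_const hr).inter (isOpen_lt continuous_const hh)

lemma convex_cylinder : Convex ℝ cylinder := by
  have h := (concaveOn_radialGap.convex_gt 0).inter (concaveOn_heightGap.convex_gt 0)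
  simpa only [cylinder_eq_inter, Set.mem_univ, true_and] using h

lemma isHilbertDomain_cylinder : IsHilbertDomain cylinder where
  nonempty := ⟨0, by simp [cylinder]⟩
  isOpen := isOpen_cylinder
  convex := convex_cylinder
  bounded := by
    refine (Metric.isBounded_closedBall (x := 0) (r := 2)).subset fun p hp => ?_
    have hr := radialGap_pos hp
    have hh := heightGap_pos hp
    unfold radialGap at hr
    unfold heightGap at hh
    rw [mem_closedBall_zero_iff, ← sq_le_sq₀ (norm_nonneg p) zero_le_two,
      EuclideanSpace.real_norm_sq_eq, Fin.sum_univ_three]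
    linarith

/-- The density of a measure comparable to the Hilbert measure of the cylinder. -/
noncomputable def cylinderWeight (p : EuclideanSpace ℝ (Fin 3)) : ℝ :=
  (radialGap p * √(radialGap p) * heightGap p)⁻¹

lemma cylinderWeight_pos (hp : p ∈ cylinder) : 0 < cylinderWeight p := by
  have hr := radialGap_pos hp
  have hh := heightGap_pos hp
  exact inv_pos.2 (by positivity)

/-- The linear map taking the Finsler unit ball of the cylinder at `p` to a set comparable to the
Euclidean unit ball. Its rows orthogonalize the Klein metric of the unit disk. -/
noncomputable def cylinderFrame (p : EuclideanSpace ℝ (Fin 3)) :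
    EuclideanSpace ℝ (Fin 3) →ₗ[ℝ] EuclideanSpace ℝ (Fin 3) :=
  Matrix.toEuclideanLin
    !![√(chordGap p) / radialGap p, p 0 * p 1 / (√(chordGap p) * radialGap p), 0;
      0, (√(chordGap p) * √(radialGap p))⁻¹, 0;
      0, 0, (heightGap p)⁻¹]

lemma det_cylinderFrame (hp : p ∈ cylinder) :
    LinearMap.det (cylinderFrame p) = cylinderWeight p := by
  have hc := chordGap_pos hp
  rw [cylinderFrame, LinearMap.det_toLpLin, Matrix.det_fin_three]
  simp only [Matrix.of_apply, Matrix.cons_val, mul_zero, sub_zero, zero_mul, add_zero,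
    cylinderWeight]
  field_simp

lemma cylinderFrame_apply (hp : p ∈ cylinder) (u : EuclideanSpace ℝ (Fin 3)) :
    cylinderFrame p u =
      !₂[(chordGap p * u 0 + p 0 * p 1 * u 1) / (√(chordGap p) * radialGap p),
        u 1 / (√(chordGap p) * √(radialGap p)), u 2 / heightGap p] := by
  have hr := radialGap_pos hp
  have hc := chordGap_pos hp
  have hsc := Real.sq_sqrt hc.le
  ext i
  fin_cases i <;>
    simp only [cylinderFrame, Matrix.toLpLin_apply, Matrix.cons_mulVec, Matrix.empty_mulVec,
      dotProduct, Fin.sum_univ_three, Matrix.cons_val, zero_mul, add_zero, zero_add, Fin.zero_eta,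
      Fin.mk_one, Fin.reduceFinMk]
  · field_simp
    rw [hsc]
    ring
  · ring
  · ring

lemma norm_sq_cylinderFrame (hp : p ∈ cylinder) (u : EuclideanSpace ℝ (Fin 3)) :
    ‖cylinderFrame p u‖ ^ 2 =
      ((p 0 * u 0 + p 1 * u 1) ^ 2 + radialGap p * (u 0 ^ 2 + u 1 ^ 2)) / radialGap p ^ 2 +
        (u 2 / heightGap p) ^ 2 := by
  have hr := radialGap_pos hp
  have hc := chordGap_pos hp
  have hquad : (chordGap p * u 0 + p 0 * p 1 * u 1) ^ 2 + radialGap p * u 1 ^ 2 =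
      chordGap p * ((p 0 * u 0 + p 1 * u 1) ^ 2 + radialGap p * (u 0 ^ 2 + u 1 ^ 2)) := by
    unfold chordGap radialGap
    ring
  rw [EuclideanSpace.real_norm_sq_eq, Fin.sum_univ_three, cylinderFrame_apply hp]
  simp only [Matrix.cons_val, div_pow, mul_pow, Real.sq_sqrt hr.le,
    Real.sq_sqrt hc.le]
  congr 1
  rw [← mul_div_mul_left _ (radialGap p ^ 2) hc.ne', ← hquad]
  field_simp

lemma norm_cylinderFrame_le_two (hp : p ∈ cylinder) (hadd : p + u ∈ cylinder)
    (hsub : p - u ∈ cylinder) : ‖cylinderFrame p u‖ ≤ 2 := by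
  have hr := radialGap_pos hp
  have hh := heightGap_pos hp
  have hradd := radialGap_pos hadd
  have hrsub := radialGap_pos hsub
  have hhadd := heightGap_pos hadd
  have hhsub := heightGap_pos hsub
  simp only [radialGap, heightGap, PiLp.add_apply, PiLp.sub_apply] at hradd hrsub hhadd hhsub
  have hdot : |p 0 * u 0 + p 1 * u 1| ≤ (radialGap p - (u 0 ^ 2 + u 1 ^ 2)) / 2 := by
    unfold radialGap
    exact abs_le.2 ⟨by linarith, by linarith⟩
  have hdisk : (p 0 * u 0 + p 1 * u 1) ^ 2 + radialGap p * (u 0 ^ 2 + u 1 ^ 2) ≤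
      radialGap p ^ 2 := by
    have hsq := (sq_le_sq₀ (abs_nonneg _) ((abs_nonneg _).trans hdot)).2 hdot
    rw [sq_abs] at hsq
    nlinarith [(abs_nonneg _).trans hdot, sq_nonneg (u 0), sq_nonneg (u 1)]
  have hheight : (u 2 / heightGap p) ^ 2 ≤ 1 := by
    have hz := abs_lt_of_sq_lt_sq (show (p 2 + u 2) ^ 2 < 1 ^ 2 by linarith) zero_le_one
    have hz' := abs_lt_of_sq_lt_sq (show (p 2 - u 2) ^ 2 < 1 ^ 2 by linarith) zero_le_one
    rw [abs_lt] at hz hz'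
    rw [sq_le_one_iff_abs_le_one, abs_div, abs_of_pos hh, div_le_one hh, heightGap, abs_le]
    constructor <;> rcases le_total 0 (p 2) with h | h <;> nlinarith
  rw [← sq_le_sq₀ (norm_nonneg _) zero_le_two, norm_sq_cylinderFrame hp]
  linarith [(div_le_one (pow_pos hr 2)).2 hdisk]

lemma add_mem_cylinder_of_norm_cylinderFrame_lt (hp : p ∈ cylinder)
    (hu : ‖cylinderFrame p u‖ < 2⁻¹) : p + u ∈ cylinder := by
  have hr := radialGap_pos hp
  have hh := heightGap_pos hp
  rw [← sq_lt_sq₀ (norm_nonneg _) (by norm_num), norm_sq_cylinderFrame hp] at hu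
  have hdisk : ((p 0 * u 0 + p 1 * u 1) ^ 2 + radialGap p * (u 0 ^ 2 + u 1 ^ 2)) /
      radialGap p ^ 2 < 4⁻¹ := by linarith [sq_nonneg (u 2 / heightGap p)]
  have hheight : |u 2 / heightGap p| < 2⁻¹ := by
    rw [← abs_of_pos (inv_pos.2 (zero_lt_two' ℝ)), ← sq_lt_sq]
    refine lt_of_le_of_lt (le_add_of_nonneg_left ?_) hu
    positivity
  rw [div_lt_iff₀ (by positivity)] at hdisk
  rw [abs_div, abs_of_pos hh, div_lt_iff₀ hh, abs_lt] at hheight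
  have hz := abs_lt.1 ((sq_lt_one_iff_abs_lt_one _).1 (sub_pos.1 hh))
  refine ⟨?_, ?_⟩
  · have hs : |p 0 * u 0 + p 1 * u 1| < radialGap p / 2 :=
      abs_lt_of_sq_lt_sq (by nlinarith [sq_nonneg (u 0), sq_nonneg (u 1)]) (by positivity)
    rw [abs_lt] at hs
    have hsum : 2 * (p 0 * u 0 + p 1 * u 1) + (u 0 ^ 2 + u 1 ^ 2) < radialGap p :=
      lt_of_mul_lt_mul_left (by nlinarith) hr.le
    simp only [PiLp.add_apply]
    unfold radialGap at hsum
    linarith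
  · simp only [PiLp.add_apply]
    unfold heightGap at hheight
    exact abs_lt.2 ⟨by nlinarith, by nlinarith⟩

lemma norm_cylinderFrame_single_zero (hp : p ∈ cylinder) :
    ‖cylinderFrame p (EuclideanSpace.single 0 1)‖ = √(chordGap p) / radialGap p := by
  have hr := radialGap_pos hp
  rw [← sq_eq_sq₀ (norm_nonneg _) (by positivity), norm_sq_cylinderFrame hp, div_pow (√_),
    Real.sq_sqrt (chordGap_pos hp).le, chordGap_eq]
  simp only [PiLp.single_apply, Fin.reduceEq, if_true, if_false]
  ring

end Cylinder

section CylinderConstants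

variable {p q : EuclideanSpace ℝ (Fin 3)} {t : Set (EuclideanSpace ℝ (Fin 3))}

lemma hilbertMeasure_cylinder_le :
    hilbertMeasure cylinder ≤ ENNReal.ofReal (2 ^ 3) • weightedMeasure cylinder cylinderWeight :=
  hilbertMeasure_le_smul_weightedMeasure isHilbertDomain_cylinder two_pos
    (fun _ => cylinderWeight_pos)
    (fun _ hp => (congrArg _ (det_cylinderFrame hp)).trans (abs_of_pos (cylinderWeight_pos hp)))
    fun _ hp _ => add_mem_cylinder_of_norm_cylinderFrame_lt hp

lemma le_hilbertMeasure_cylinder :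
    ENNReal.ofReal ((2 * 2) ^ 3)⁻¹ • weightedMeasure cylinder cylinderWeight ≤
      hilbertMeasure cylinder :=
  smul_weightedMeasure_le_hilbertMeasure isHilbertDomain_cylinder two_pos
    (fun _ => cylinderWeight_pos)
    (fun _ hp => (congrArg _ (det_cylinderFrame hp)).trans (abs_of_pos (cylinderWeight_pos hp)))
    fun _ hp _ => norm_cylinderFrame_le_two hp

/-- A primitive of `cylinderWeight` along the first axis. -/
noncomputable def flux (p : EuclideanSpace ℝ (Fin 3)) : ℝ :=
  p 0 / √(radialGap p) / (chordGap p * heightGap p)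

lemma hasDerivAt_div_sqrt_sub_sq {c x : ℝ} (h : 0 < c - x ^ 2) :
    HasDerivAt (fun x => x / √(c - x ^ 2)) (c / ((c - x ^ 2) * √(c - x ^ 2))) x := by
  have hs := Real.sq_sqrt h.le
  have hpos := Real.sqrt_pos.2 h
  have hsqrt := ((hasDerivAt_pow 2 x).const_sub c).sqrt h.ne'
  refine ((hasDerivAt_id x).div hsqrt hpos.ne').congr_deriv ?_
  generalize √(c - x ^ 2) = s at hs hpos
  rw [← hs]
  field_simp
  simp only [id]
  linear_combination 2 * hs

lemma hasLineDerivAt_flux (hp : p ∈ cylinder) :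
    HasLineDerivAt ℝ flux (cylinderWeight p) p (EuclideanSpace.single 0 1) := by
  have hr := radialGap_pos hp
  have hc := chordGap_pos hp
  have hgap : chordGap p - (p 0 + 0) ^ 2 = radialGap p := by rw [chordGap_eq]; ring
  have hline : (fun t : ℝ => flux (p + t • EuclideanSpace.single 0 1)) = fun t =>
      (p 0 + t) / √(chordGap p - (p 0 + t) ^ 2) / (chordGap p * heightGap p) := by
    ext t
    simp [flux, chordGap, radialGap, heightGap, sub_right_comm]
  rw [HasLineDerivAt, hline]
  have hd := (hasDerivAt_div_sqrt_sub_sq (hgap.symm ▸ hr)).comp_const_add (p 0) 0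
  refine (hd.div_const _).congr_deriv ?_
  rw [hgap, cylinderWeight]
  field_simp

lemma contDiffAt_flux (hp : p ∈ cylinder) : ContDiffAt ℝ 1 flux p := by
  have hr := radialGap_pos hp
  have hc := chordGap_pos hp
  have hh := heightGap_pos hp
  have hx : ContDiffAt ℝ 1 (fun q : EuclideanSpace ℝ (Fin 3) => q 0) p := by fun_prop
  have hrad : ContDiffAt ℝ 1 radialGap p := by unfold radialGap; fun_prop
  have hden : ContDiffAt ℝ 1 (fun q => chordGap q * heightGap q) p := by
    unfold chordGap heightGap
    fun_prop
  exact (hx.div (hrad.sqrt hr.ne') (by positivity)).div hden (by positivity)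

lemma isPrimitiveAlong_flux :
    IsPrimitiveAlong cylinder (EuclideanSpace.single 0 1) flux cylinderWeight where
  contDiffOn _ hp := (contDiffAt_flux hp).contDiffWithinAt
  hasLineDerivAt _ := hasLineDerivAt_flux
  pos _ := cylinderWeight_pos

/-- Up to bounded factors, the area of the projection along the first axis of the Finsler unit ball
at `p`. -/
noncomputable def shadowArea (p : EuclideanSpace ℝ (Fin 3)) : ℝ :=
  √(chordGap p) * √(radialGap p) * heightGap p

lemma shadowArea_pos (hp : p ∈ cylinder) : 0 < shadowArea p := by
  have hr := radialGap_pos hp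
  have hc := chordGap_pos hp
  have hh := heightGap_pos hp
  unfold shadowArea
  positivity

lemma abs_flux_le (hp : p ∈ cylinder) : |flux p| ≤ (shadowArea p)⁻¹ := by
  have hr := radialGap_pos hp
  have hc := chordGap_pos hp
  have hh := heightGap_pos hp
  have hx : |p 0| ≤ √(chordGap p) := by
    refine Real.abs_le_sqrt ?_
    rw [chordGap_eq]
    linarith
  calc |flux p| = |p 0| / √(radialGap p) / (chordGap p * heightGap p) := by
        rw [flux, abs_div, abs_div, abs_of_pos (Real.sqrt_pos.2 hr), abs_of_pos (mul_pos hc hh)]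
    _ ≤ √(chordGap p) / √(radialGap p) / (chordGap p * heightGap p) := by gcongr
    _ = (shadowArea p)⁻¹ := by
        rw [shadowArea]
        field_simp
        exact Real.sq_sqrt hc.le

lemma finslerNorm_cylinder_single_zero_le (hp : p ∈ cylinder) :
    finslerNorm cylinder p (EuclideanSpace.single 0 1) ≤ 2 * (√(chordGap p) / radialGap p) := by
  rw [← norm_cylinderFrame_single_zero hp]
  exact finslerNorm_le_mul_norm_map isHilbertDomain_cylinder hp (cylinderFrame p) two_pos
    fun _ => add_mem_cylinder_of_norm_cylinderFrame_lt hp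

lemma abs_flux_mul_finslerNorm_le (hp : p ∈ cylinder) :
    |flux p| * finslerNorm cylinder p (EuclideanSpace.single 0 1) ≤ 2 * cylinderWeight p := by
  have hr := radialGap_pos hp
  have hc := chordGap_pos hp
  have hh := heightGap_pos hp
  have hs := shadowArea_pos hp
  calc |flux p| * finslerNorm cylinder p (EuclideanSpace.single 0 1)
      ≤ (shadowArea p)⁻¹ * (2 * (√(chordGap p) / radialGap p)) :=
        mul_le_mul (abs_flux_le hp) (finslerNorm_cylinder_single_zero_le hp)
          (finslerNorm_nonneg isHilbertDomain_cylinder hp) (by positivity)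
    _ = 2 * cylinderWeight p := by
        rw [shadowArea, cylinderWeight]
        field_simp

lemma bottomOfSpectrum_cylinder_pos : 0 < bottomOfSpectrum cylinder :=
  bottomOfSpectrum_pos isHilbertDomain_cylinder isPrimitiveAlong_flux
    (fun _ => abs_flux_mul_finslerNorm_le) (ENNReal.ofReal_pos.2 (by norm_num)).ne'
    ENNReal.ofReal_ne_top le_hilbertMeasure_cylinder hilbertMeasure_cylinder_le

lemma shadowArea_le_nine_mul (hp : p ∈ cylinder) (hq : q ∈ cylinder)
    (hd : hilbertDist cylinder p q ≤ 1 / 2) : shadowArea p ≤ 9 * shadowArea q := by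
  have hexp : Real.exp (2 * hilbertDist cylinder p q) ≤ 3 :=
    (Real.exp_le_exp.2 (by linarith)).trans Real.exp_one_lt_three.le
  have hgap {g : EuclideanSpace ℝ (Fin 3) → ℝ} (hg : ConcaveOn ℝ Set.univ g)
      (hpos : ∀ x ∈ cylinder, 0 < g x) : g p ≤ 3 * g q :=
    (le_exp_hilbertDist_mul_of_concaveOn isHilbertDomain_cylinder
      (hg.subset (Set.subset_univ _) convex_cylinder) (fun x hx => (hpos x hx).le) hp hq).trans
      (mul_le_mul_of_nonneg_right hexp (hpos q hq).le)
  have hr := hgap concaveOn_radialGap fun _ => radialGap_pos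
  have hc := hgap concaveOn_chordGap fun _ => chordGap_pos
  have hh := hgap concaveOn_heightGap fun _ => heightGap_pos
  have := heightGap_pos hq
  have := heightGap_pos hp
  calc shadowArea p ≤ √(3 * chordGap q) * √(3 * radialGap q) * (3 * heightGap q) := by
        rw [shadowArea]
        gcongr
    _ = √3 * √3 * (3 * shadowArea q) := by
        rw [Real.sqrt_mul zero_le_three, Real.sqrt_mul zero_le_three, shadowArea]
        ring
    _ = 9 * shadowArea q := by
        rw [Real.mul_self_sqrt zero_le_three]
        ring

lemma abs_coord_sub_le (hp : p ∈ cylinder) (hq : q ∈ cylinder) {d : ℝ} (hd : d ≤ 1 / 2)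
    (hdist : hilbertDist cylinder p q ≤ d) :
    |q 1 - p 1| ≤ 16 * d * (√(chordGap p) * √(radialGap p)) ∧
      |q 2 - p 2| ≤ 16 * d * heightGap p := by
  have hC := isHilbertDomain_cylinder
  have hr := radialGap_pos hp
  have hc := chordGap_pos hp
  have hh := heightGap_pos hp
  have hs : 0 < √(chordGap p) * √(radialGap p) := by positivity
  have hnorm : ‖cylinderFrame p (q - p)‖ ≤ 16 * d := by
    linarith [finslerNorm_sub_le_four_mul_hilbertDist hC hp hq (hdist.trans hd),
      norm_map_le_mul_finslerNorm hC hp (cylinderFrame p) (u := q - p)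
        fun _ => norm_cylinderFrame_le_two hp]
  have hcoord (i : Fin 3) : |cylinderFrame p (q - p) i| ≤ 16 * d :=
    (PiLp.norm_apply_le _ i).trans hnorm
  rw [cylinderFrame_apply hp] at hcoord
  have h1 := hcoord 1
  have h2 := hcoord 2
  simp only [Matrix.cons_val, PiLp.sub_apply, abs_div] at h1 h2
  rw [abs_of_pos hs, div_le_iff₀ hs] at h1
  rw [abs_of_pos hh, div_le_iff₀ hh] at h2
  exact ⟨h1, h2⟩

lemma ofReal_hilbertDist_le_hilbertDiam {n : ℕ} {C t : Set (EuclideanSpace ℝ (Fin n))}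
    {p q : EuclideanSpace ℝ (Fin n)} (hp : p ∈ t) (hq : q ∈ t) :
    ENNReal.ofReal (hilbertDist C p q) ≤ hilbertDiam C t :=
  le_iSup₂_of_le p hp (le_iSup₂_of_le q hq le_rfl)

lemma volume_tailPoint_image_le (ht : t ⊆ cylinder) (hp : p ∈ t) {d : ℝ} (hd : d ≤ 1 / 2)
    (hdist : ∀ q ∈ t, hilbertDist cylinder p q ≤ d) :
    volume (tailPoint '' t) ≤ ENNReal.ofReal (32 ^ 2 * shadowArea p * d ^ 2) := by
  have hd0 : 0 ≤ d := (hilbertDist_nonneg isHilbertDomain_cylinder (ht hp) (ht hp)).trans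
    (hdist p hp)
  have := heightGap_pos (ht hp)
  set R : Fin 2 → ℝ := ![16 * d * (√(chordGap p) * √(radialGap p)), 16 * d * heightGap p]
  have hR0 : 0 ≤ R 0 := by
    simp only [R, Matrix.cons_val]
    positivity
  have hbox : tailPoint '' t ⊆ Set.Icc (tailPoint p - R) (tailPoint p + R) := by
    rintro _ ⟨q, hq, rfl⟩
    have hR : ∀ i, |tailPoint q i - tailPoint p i| ≤ R i :=
      Fin.forall_fin_two.2 (abs_coord_sub_le (ht hp) (ht hq) hd (hdist q hq))
    exact ⟨fun i => sub_le_of_abs_sub_le_left (hR i),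
      fun i => sub_le_iff_le_add'.1 (abs_sub_le_iff.1 (hR i)).1⟩
  calc volume (tailPoint '' t) ≤ volume (Set.Icc (tailPoint p - R) (tailPoint p + R)) :=
        measure_mono hbox
    _ = ENNReal.ofReal (2 * R 0) * ENNReal.ofReal (2 * R 1) := by
        simp [Real.volume_Icc_pi, Fin.prod_univ_two, two_mul]
    _ = ENNReal.ofReal (32 ^ 2 * shadowArea p * d ^ 2) := by
        rw [← ENNReal.ofReal_mul (by positivity)]
        congr 1
        simp only [R, Matrix.cons_val, shadowArea]
        ring

lemma cheegerConstant_cylinder_pos : 0 < cheegerConstant cylinder := by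
  refine cheegerConstant_pos isOpen_cylinder convex_cylinder isPrimitiveAlong_flux
    (r := ENNReal.ofReal (1 / 2)) (A := ENNReal.ofReal (9 * 32 ^ 2))
    (ENNReal.ofReal_pos.2 (by norm_num)) ENNReal.ofReal_ne_top ENNReal.ofReal_ne_top
    hilbertMeasure_cylinder_le fun t ht ⟨p, hp⟩ hdiam => ?_
  have hs := shadowArea_pos (ht hp)
  have hfin : hilbertDiam cylinder t ≠ ∞ := ne_top_of_le_ne_top ENNReal.ofReal_ne_top hdiam
  set d := (hilbertDiam cylinder t).toReal with hd_def
  have hd : d ≤ 1 / 2 := ENNReal.toReal_le_of_le_ofReal (by norm_num) hdiam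
  have hdist {x y} (hx : x ∈ t) (hy : y ∈ t) : hilbertDist cylinder x y ≤ d :=
    (ENNReal.ofReal_le_iff_le_toReal hfin).1 (ofReal_hilbertDist_le_hilbertDiam hx hy)
  have hflux : ⨆ q ∈ t, ENNReal.ofReal |flux q| ≤ ENNReal.ofReal (9 * (shadowArea p)⁻¹) := by
    refine iSup₂_le fun q hq => ENNReal.ofReal_le_ofReal ((abs_flux_le (ht hq)).trans ?_)
    have hsq := shadowArea_pos (ht hq)
    rw [← div_eq_mul_inv, inv_le_comm₀ hsq (by positivity), inv_div, div_le_iff₀' (by positivity)]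
    exact shadowArea_le_nine_mul (ht hp) (ht hq) ((hdist hp hq).trans hd)
  calc (⨆ q ∈ t, ENNReal.ofReal |flux q|) * volume (tailPoint '' t)
      ≤ ENNReal.ofReal (9 * (shadowArea p)⁻¹) *
          ENNReal.ofReal (32 ^ 2 * shadowArea p * d ^ 2) :=
        mul_le_mul' hflux (volume_tailPoint_image_le ht hp hd fun _ => hdist hp)
    _ = ENNReal.ofReal (9 * 32 ^ 2) * hilbertDiam cylinder t ^ 2 := by
        rw [← ENNReal.ofReal_toReal hfin, ← ENNReal.ofReal_pow ENNReal.toReal_nonneg,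
          ← ENNReal.ofReal_mul (by positivity), ← ENNReal.ofReal_mul (by norm_num)]
        congr 1
        rw [← hd_def]
        field_simp

end CylinderConstants

section PlaneSection

/-- Points of the plane `y = 0`, which cuts the cylinder in a square. -/
def planePoint (a b : ℝ) : EuclideanSpace ℝ (Fin 3) := !₂[a, 0, b]

variable {a b c d s : ℝ}

lemma planePoint_mem_cylinder_iff : planePoint a b ∈ cylinder ↔ |a| < 1 ∧ |b| < 1 := by
  simp [planePoint, cylinder]

lemma smul_planePoint_add_smul_planePoint (a b c d s t : ℝ) :
    s • planePoint a b + t • planePoint c d = planePoint (s * a + t * c) (s * b + t * d) := by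
  ext i
  fin_cases i <;> simp [planePoint]

lemma continuous_planePoint : Continuous (Function.uncurry planePoint) := by
  refine (PiLp.continuous_toLp 2 _).comp (continuous_pi fun i => ?_)
  fin_cases i
  · exact continuous_fst
  · exact continuous_const
  · exact continuous_snd

lemma planePoint_mem_closure_cylinder (ha : a ∈ Set.Icc (-1) 1) (hb : b ∈ Set.Icc (-1) 1) :
    planePoint a b ∈ closure cylinder := by
  rw [← closure_Ioo (by norm_num)] at ha hb
  exact map_mem_closure₂ continuous_planePoint ha hb fun x hx y hy =>
    planePoint_mem_cylinder_iff.2 ⟨abs_lt.2 hx, abs_lt.2 hy⟩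

lemma not_strictConvex_closure_cylinder : ¬ StrictConvex ℝ (closure cylinder) := by
  intro h
  have hne : planePoint 1 (-1) ≠ planePoint 1 1 := fun e => by
    have hz : (-1 : ℝ) = 1 := congrArg (fun v => v 2) e
    norm_num at hz
  have hmem (b : ℝ) (hb : b ∈ Set.Icc (-1) 1) : planePoint 1 b ∈ closure cylinder :=
    planePoint_mem_closure_cylinder ⟨by norm_num, le_rfl⟩ hb
  have hmid := h (hmem (-1) (by norm_num)) (hmem 1 (by norm_num)) hne
    (half_pos one_pos) (half_pos one_pos) (add_halves 1)
  rw [convex_cylinder.interior_closure_eq_interior_of_nonempty_interior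
    (by simpa only [isOpen_cylinder.interior_eq] using isHilbertDomain_cylinder.nonempty),
    isOpen_cylinder.interior_eq, smul_planePoint_add_smul_planePoint,
    planePoint_mem_cylinder_iff] at hmid
  norm_num at hmid

/-- The Funk norm of the interval `(-1, 1)`. -/
noncomputable def intervalFunkNorm (a u : ℝ) : ℝ := max (u / (1 - a)) (-u / (1 + a))

lemma intervalFunkNorm_zero_right (a : ℝ) : intervalFunkNorm a 0 = 0 := by
  simp [intervalFunkNorm]

lemma intervalFunkNorm_zero_left (u : ℝ) : intervalFunkNorm 0 u = |u| := by
  simp [intervalFunkNorm, abs_eq_max_neg]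

lemma intervalFunkNorm_self (hs0 : 0 ≤ s) (hs1 : s < 1) : intervalFunkNorm s s = s / (1 - s) :=
  max_eq_left <| (div_nonpos_of_nonpos_of_nonneg (by linarith) (by linarith)).trans
    (div_nonneg hs0 (by linarith))

lemma intervalFunkNorm_nonneg (ha : |a| < 1) (u : ℝ) : 0 ≤ intervalFunkNorm a u := by
  rw [abs_lt] at ha
  rcases le_total 0 u with hu | hu
  · exact le_max_of_le_left (div_nonneg hu (by linarith))
  · exact le_max_of_le_right (div_nonneg (by linarith) (by linarith))

lemma abs_add_inv_mul_lt_one_iff (ha : |a| < 1) {u : ℝ} (hs : 0 < s) :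
    |a + s⁻¹ * u| < 1 ↔ intervalFunkNorm a u < s := by
  rw [abs_lt] at ha
  rw [intervalFunkNorm, max_lt_iff, div_lt_iff₀ (by linarith), div_lt_iff₀ (by linarith), abs_lt,
    and_comm, ← lt_sub_iff_add_lt', inv_mul_lt_iff₀ hs, neg_lt, neg_add_rev,
    ← lt_sub_iff_add_lt, ← mul_neg, inv_mul_lt_iff₀ hs, sub_neg_eq_add]

lemma funkNorm_planePoint (ha : |a| < 1) (hb : |b| < 1) (u v : ℝ) :
    funkNorm cylinder (planePoint a b) (planePoint u v) =
      max (intervalFunkNorm a u) (intervalFunkNorm b v) := by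
  have hmax0 : 0 ≤ max (intervalFunkNorm a u) (intervalFunkNorm b v) :=
    le_max_of_le_left (intervalFunkNorm_nonneg ha u)
  refine eq_of_forall_gt_iff fun s => ?_
  rcases le_or_gt s 0 with hs | hs
  · exact iff_of_false (hs.trans funkNorm_nonneg).not_gt (hs.trans hmax0).not_gt
  · have hline := smul_planePoint_add_smul_planePoint a b u v 1 s⁻¹
    simp only [one_smul, one_mul] at hline
    rw [funkNorm_lt_iff isHilbertDomain_cylinder (planePoint_mem_cylinder_iff.2 ⟨ha, hb⟩) hs,
      hline, planePoint_mem_cylinder_iff, max_lt_iff, abs_add_inv_mul_lt_one_iff ha hs,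
      abs_add_inv_mul_lt_one_iff hb hs]

lemma hilbertDist_planePoint (ha : |a| < 1) (hb : |b| < 1) (hc : |c| < 1) (hd : |d| < 1) :
    hilbertDist cylinder (planePoint a b) (planePoint c d) = Real.log
      ((1 + max (intervalFunkNorm a (a - c)) (intervalFunkNorm b (b - d))) *
        (1 + max (intervalFunkNorm c (c - a)) (intervalFunkNorm d (d - b)))) / 2 := by
  have hsub (a b c d : ℝ) : planePoint a b - planePoint c d = planePoint (a - c) (b - d) := by
    simpa [sub_eq_add_neg] using smul_planePoint_add_smul_planePoint a b c d 1 (-1)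
  rw [← funkNorm_planePoint ha hb, ← funkNorm_planePoint hc hd, ← hsub, ← hsub,
    ← exp_two_mul_hilbertDist isHilbertDomain_cylinder (planePoint_mem_cylinder_iff.2 ⟨ha, hb⟩)
      (planePoint_mem_cylinder_iff.2 ⟨hc, hd⟩), Real.log_exp, mul_div_cancel_left₀ _ two_ne_zero]

lemma hilbertDist_square_side (hs0 : 0 ≤ s) (hs1 : s < 1) :
    let D := Real.log ((1 + s) / (1 - s)) / 2
    hilbertDist cylinder (planePoint s 0) (planePoint 0 0) = D ∧
      hilbertDist cylinder (planePoint s s) (planePoint 0 0) = D ∧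
      hilbertDist cylinder (planePoint 0 s) (planePoint 0 0) = D ∧
      hilbertDist cylinder (planePoint s 0) (planePoint s s) = D ∧
      hilbertDist cylinder (planePoint s s) (planePoint 0 s) = D := by
  have h0abs : |(0 : ℝ)| < 1 := by norm_num
  have hdiv : 0 ≤ s / (1 - s) := div_nonneg hs0 (sub_pos.2 hs1).le
  have hmul : (1 + s / (1 - s)) * (1 + s) = (1 + s) / (1 - s) := by
    field_simp [(sub_pos.2 hs1).ne']
    ring
  refine ⟨?_, ?_, ?_, ?_, ?_⟩ <;>
    simp only [hilbertDist_planePoint, hs1, h0abs, sub_self, sub_zero, zero_sub,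
      intervalFunkNorm_zero_right, intervalFunkNorm_zero_left, intervalFunkNorm_self hs0 hs1,
      abs_neg, abs_of_nonneg hs0, max_self, max_eq_left hs0, max_eq_right hs0, max_eq_left hdiv,
      max_eq_right hdiv, mul_comm (1 + s) (1 + _), hmul]

lemma hilbertDist_square_diagonal (hs0 : 0 ≤ s) (hs1 : s < 1) :
    hilbertDist cylinder (planePoint s 0) (planePoint 0 s) = -Real.log (1 - s) := by
  have hsabs : |s| < 1 := (abs_of_nonneg hs0).trans_lt hs1
  have h0abs : |(0 : ℝ)| < 1 := by norm_num
  have hle : s ≤ s / (1 - s) := le_div_self hs0 (sub_pos.2 hs1) (sub_le_self 1 hs0)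
  have hinv : 1 + s / (1 - s) = (1 - s)⁻¹ := by
    rw [one_add_div (sub_pos.2 hs1).ne', sub_add_cancel, one_div]
  rw [hilbertDist_planePoint hsabs h0abs h0abs hsabs]
  simp only [sub_zero, zero_sub, intervalFunkNorm_zero_left, intervalFunkNorm_self hs0 hs1,
    abs_neg, abs_of_nonneg hs0, max_eq_left hle, max_eq_right hle, hinv, ← pow_two, inv_pow,
    Real.log_inv, Real.log_pow]
  ring

lemma not_isGromovHyperbolic_cylinder : ¬ IsGromovHyperbolic cylinder := by
  rintro ⟨δ, hδ, h⟩
  set s : ℝ := 1 - Real.exp (-(4 * δ + 1)) with hs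
  have hs0 : 0 < s := sub_pos.2 (Real.exp_lt_one_iff.2 (by linarith))
  have hs1 : s < 1 := sub_lt_self 1 (Real.exp_pos _)
  have hsabs : |s| < 1 := (abs_of_pos hs0).trans_lt hs1
  have h0abs : |(0 : ℝ)| < 1 := by norm_num
  obtain ⟨hxw, hyw, hzw, hxy, hyz⟩ := hilbertDist_square_side hs0.le hs1
  have hgromov := h (planePoint 0 0) (planePoint_mem_cylinder_iff.2 ⟨h0abs, h0abs⟩)
    (planePoint s 0) (planePoint_mem_cylinder_iff.2 ⟨hsabs, h0abs⟩)
    (planePoint s s) (planePoint_mem_cylinder_iff.2 ⟨hsabs, hsabs⟩)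
    (planePoint 0 s) (planePoint_mem_cylinder_iff.2 ⟨h0abs, hsabs⟩)
  simp only [gromovProduct, hxw, hyw, hzw, hxy, hyz, hilbertDist_square_diagonal hs0.le hs1,
    add_sub_cancel_right, min_self] at hgromov
  have hlog : Real.log (1 - s) = -(4 * δ + 1) := by rw [hs, sub_sub_cancel, Real.log_exp]
  have hlog_add : Real.log (1 + s) < 1 := by
    linarith [Real.log_le_sub_one_of_pos (by linarith : 0 < 1 + s)]
  rw [Real.log_div (by linarith) (by linarith), hlog] at hgromov
  linarith

end PlaneSection

end HilbertGeometry

theorem proposition4p1 :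
    HilbertGeometry.IsHilbertDomain HilbertGeometry.cylinder ∧
    0 < HilbertGeometry.cheegerConstant HilbertGeometry.cylinder ∧
    0 < HilbertGeometry.bottomOfSpectrum HilbertGeometry.cylinder ∧
    ¬ StrictConvex ℝ (closure HilbertGeometry.cylinder) ∧
    ¬ HilbertGeometry.IsGromovHyperbolic HilbertGeometry.cylinder ∧
    (¬ ∀ C : Set (EuclideanSpace ℝ (Fin 3)), HilbertGeometry.IsHilbertDomain C →
      0 < HilbertGeometry.bottomOfSpectrum C → HilbertGeometry.IsGromovHyperbolic C) ∧
    (¬ ∀ C : Set (EuclideanSpace ℝ (Fin 3)), HilbertGeometry.IsHilbertDomain C →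
      0 < HilbertGeometry.cheegerConstant C → HilbertGeometry.IsGromovHyperbolic C) :=
  ⟨HilbertGeometry.isHilbertDomain_cylinder, HilbertGeometry.cheegerConstant_cylinder_pos,
    HilbertGeometry.bottomOfSpectrum_cylinder_pos,
    HilbertGeometry.not_strictConvex_closure_cylinder,
    HilbertGeometry.not_isGromovHyperbolic_cylinder,
    fun h => HilbertGeometry.not_isGromovHyperbolic_cylinder
      (h _ HilbertGeometry.isHilbertDomain_cylinder HilbertGeometry.bottomOfSpectrum_cylinder_pos),
    fun h => HilbertGeometry.not_isGromovHyperbolic_cylinder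
      (h _ HilbertGeometry.isHilbertDomain_cylinder HilbertGeometry.cheegerConstant_cylinder_pos)⟩
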